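/- Let $N\ge 1$, let $H\in C^2([0,\infty))$ satisfy $H(\xi)>0$ and $H'(\xi)>0$ for $\xi>0$, $\lim_{\xi\to\infty}H(\xi)=\infty$, and let $H'$ be nondecreasing on some half-line $[R,\infty)$. Let $u_0\ge 0$ be a measurable function on $\mathbb{R}^N$. Notation. Put $\|\varphi\|_{L^1_{\rm ul}}:=\sup_{y\in\mathbb{R}^N}\int_{B(y,1)}|\varphi(x)|\,dx$ and $L^1_{\rm ul}:=\{\varphi\in L^1_{\rm loc}(\mathbb{R}^N):\|\varphi\|_{L^1_{\rm ul}}<\infty\}$; let $\mathcal{L}^1_{\rm ul}$ be the closure in $L^1_{\rm ul}$ of the space of bounded uniformly continuous functions on $\mathbb{R}^N$. Let $[e^{t\Delta}\varphi](x)=\int_{\mathbb{R}^N}(4\pi t)^{-N/2}e^{-|x-y|^2/(4t)}\varphi(y)\,dy$. For $0<\gamma<\min\{2,N\}$, consider $$\partial_t u-\Delta u=|x|^{-\gamma}f(u)\ \text{ in }\mathbb{R}^N\times(0,T),\qquad u(\cdot,0)=u_0. \tag{P}$$ A solution of (P) in $\mathbb{R}^N\times(0,T)$ is a nonnegative measurable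 function $u\in L^\infty((0,T),L^1_{\rm ul})\cap L^\infty_{\rm loc}((0,T),L^\infty(\mathbb{R}^N))$ such that, for every $0<t<T$ and almost every $x\in\mathbb{R}^N$, $$u(x,t)=[e^{t\Delta}u_0](x)+\int_0^t\bigl[e^{(t-s)\Delta}\bigl(|\cdot|^{-\gamma}f(u(\cdot,s))\bigr)\bigr](x)\,ds .$$ For $\theta\in(0,1]$ and $\zeta\ge0$ define, with values in $[0,\infty]$, $$\Phi(\xi):=\sup_{\zeta\le\sigma\le\xi}\frac{H'(\sigma)}{H(\sigma)^{1-\theta}},\qquad \Psi(\xi):=\sup_{\zeta\le\sigma\le\xi}\frac{f(\sigma)}{H(\sigma)^{\theta}},$$ $$Q(\eta):=\Phi(\eta)\int_\eta^\infty\frac{\Psi(\tau)H'(\tau)}{H(\tau)^{1+\frac{2-\gamma}{N}}}\left(1-\left(\frac{H(\eta)}{H(\tau)}\right)^{\frac2N}\right)^{-\frac{\gamma}{2}}d\tau .$$ Statement. There is a constant $C>0$, depending only on $N$, $H$ and $u_0$, with the following property. Let $0<\gamma<\min\{2,N\}$, let $f\in C([0,\infty))$ be nonnegative and nondecreasing on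 $(0,\infty)$, and suppose that there are $\theta\in(0,1]$ and $\zeta\ge0$ such that one of the following holds: (i) $H(u_0)\in L^1_{\rm ul}$ and $\lim_{\eta\to\infty}Q(\eta)=0$; (ii) $H(u_0)\in\mathcal{L}^1_{\rm ul}$ and $\limsup_{\eta\to\infty}Q(\eta)<\infty$. Then there exist $T>0$ and a nonnegative solution $u$ of (P) in $\mathbb{R}^N\times(0,T)$ such that $\|H(u(t))\|_{L^1_{\rm ul}}\le C$ for all $0<t<T$. -/

import Mathlib

open MeasureTheory Set Filter Topology
open scoped ENNReal NNReal

noncomputable section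

namespace HardyParabolic

/-- The Euclidean space `ℝ^N`. -/
abbrev E (N : ℕ) : Type := EuclideanSpace ℝ (Fin N)

/-- The uniformly local norm `sup_y ∫_{B(y,1)} |φ| dx`, with values in `[0,∞]`. -/
def ulNorm {N : ℕ} (φ : E N → ℝ) : ℝ≥0∞ :=
  ⨆ y : E N, ∫⁻ x in Metric.ball y 1, ‖φ x‖ₑ

/-- `φ ∈ L¹_ul(ℝ^N)`. -/
def MemLul {N : ℕ} (φ : E N → ℝ) : Prop :=
  LocallyIntegrable φ volume ∧ ulNorm φ < ⊤

/-- `g ∈ BUC(ℝ^N)`: bounded and uniformly continuous. -/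
def IsBUC {N : ℕ} (g : E N → ℝ) : Prop :=
  UniformContinuous g ∧ ∃ M : ℝ, ∀ x, |g x| ≤ M

/-- `φ` belongs to the closure of `BUC(ℝ^N)` in `L¹_ul(ℝ^N)`. -/
def MemLulClosure {N : ℕ} (φ : E N → ℝ) : Prop :=
  MemLul φ ∧ ∀ ε : ℝ≥0∞, 0 < ε → ∃ g : E N → ℝ, IsBUC g ∧ ulNorm (fun x => φ x - g x) < ε

/-- The Gauss kernel `G(x,t) = (4πt)^{-N/2} exp(-|x|²/(4t))`. -/
def heatKernel {N : ℕ} (x : E N) (t : ℝ) : ℝ :=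
  (4 * Real.pi * t) ^ (-((N : ℝ) / 2)) * Real.exp (-(‖x‖ ^ 2 / (4 * t)))

/-- The heat semigroup `[e^{tΔ} φ](x) = ∫ G(x-y,t) φ(y) dy` on functions with values in
`[0,∞]`, so that the integral is always meaningful. -/
def heatFlow {N : ℕ} (t : ℝ) (φ : E N → ℝ≥0∞) (x : E N) : ℝ≥0∞ :=
  ∫⁻ y, ENNReal.ofReal (heatKernel (x - y) t) * φ y

/-- `u` is a nonnegative solution in `ℝ^N × (0,T)` of `∂ₜu - Δu = |x|^{-γ} f(u)`, `u(·,0) = u₀`.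
All functions in the integral equation are nonnegative, so it is written as an identity in `[0,∞]`;
its left-hand side is finite, hence so are both terms on the right. -/
structure IsSolution {N : ℕ} (γ : ℝ) (f : ℝ → ℝ) (u₀ : E N → ℝ) (T : ℝ) (u : E N → ℝ → ℝ) :
    Prop where
  measurable : Measurable (fun p : E N × Ioo (0 : ℝ) T => u p.1 p.2)
  nonneg : ∀ x, ∀ t ∈ Ioo (0 : ℝ) T, 0 ≤ u x t
  /-- `u ∈ L^∞((0,T), L¹_ul)`. -/
  bounded_ul : ∃ M : ℝ≥0, ∀ᵐ t ∂(volume.restrict (Ioo (0 : ℝ) T)),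
    MemLul (fun x => u x t) ∧ ulNorm (fun x => u x t) ≤ M
  /-- `u ∈ L^∞_loc((0,T), L^∞)`. -/
  locally_bounded : ∀ a b : ℝ, 0 < a → b < T → ∃ M : ℝ≥0,
    ∀ᵐ t ∂(volume.restrict (Icc a b)), eLpNorm (fun x => u x t) ⊤ volume ≤ M
  /-- The integral equation. -/
  mild : ∀ t ∈ Ioo (0 : ℝ) T, ∀ᵐ x : E N,
    ENNReal.ofReal (u x t) =
      heatFlow t (fun y => ENNReal.ofReal (u₀ y)) x +
        ∫⁻ s in Ioo (0 : ℝ) t,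
          heatFlow (t - s) (fun y => ENNReal.ofReal (‖y‖ ^ (-γ) * f (u y s))) x

/-- The derivative of a function on `[0,∞)`, one-sided at `0`. -/
def D (H : ℝ → ℝ) (ξ : ℝ) : ℝ := derivWithin H (Ici 0) ξ

/-- `H ∈ C²([0,∞))`, `H → ∞`, `H > 0` and `H' > 0` on `(0,∞)`, and `H'` is nondecreasing for
large arguments. -/
structure CondH (H : ℝ → ℝ) : Prop where
  contDiff : ContDiffOn ℝ 2 H (Ici 0)
  tendsto : Tendsto H atTop atTop
  pos : ∀ ξ, 0 < ξ → 0 < H ξ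
  deriv_pos : ∀ ξ, 0 < ξ → 0 < D H ξ
  deriv_mono : ∃ R : ℝ, 0 < R ∧ MonotoneOn (D H) (Ici R)

/-- `Φ(ξ) = sup_{ζ ≤ σ ≤ ξ} H'(σ) / H(σ)^{1-θ}`, with values in `[0,∞]`. -/
def Phi (H : ℝ → ℝ) (θ ζ ξ : ℝ) : ℝ≥0∞ :=
  ⨆ σ ∈ Icc ζ ξ, ENNReal.ofReal (D H σ) / ENNReal.ofReal (H σ) ^ (1 - θ)

/-- `Ψ(ξ) = sup_{ζ ≤ σ ≤ ξ} f(σ) / H(σ)^θ`, with values in `[0,∞]`. -/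
def Psi (f H : ℝ → ℝ) (θ ζ ξ : ℝ) : ℝ≥0∞ :=
  ⨆ σ ∈ Icc ζ ξ, ENNReal.ofReal (f σ) / ENNReal.ofReal (H σ) ^ θ

/-- The quantity
`Φ(η) ∫_η^∞ Ψ(τ) H'(τ) / H(τ)^{1+(2-γ)/N} (1 - (H(η)/H(τ))^{2/N})^{-γ/2} dτ` in `[0,∞]`. -/
def quantity (N : ℕ) (γ : ℝ) (f H : ℝ → ℝ) (θ ζ η : ℝ) : ℝ≥0∞ :=
  Phi H θ ζ η *
    ∫⁻ τ in Ioi η, Psi f H θ ζ τ *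
      ENNReal.ofReal (D H τ / H τ ^ (1 + (2 - γ) / (N : ℝ)) *
        (1 - (H η / H τ) ^ (2 / (N : ℝ))) ^ (-(γ / 2)))

end HardyParabolic

end

noncomputable section

namespace HardyParabolic

/-! Let w = max(u₀, R), with H convex on [R, ∞). For small t the function p = H⁻¹(2 e^{tΔ}H(w)) is a
supersolution. Monotone iteration from 0 yields a solution u ≤ p, and H(u) ≤ 2 e^{tΔ}H(w) gives the
uniformly local bound.

Write v = e^{tΔ}H(w). Averaging the tangent inequality of H at the number p(x,t) against the
Gaussian gives H'(p) e^{tΔ}w + v ≤ H'(p) p. The factor 2 thus leaves a margin v, into which H'(p)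
times the source term must fit (`duhamel_supersolution_le`).

The Hardy weight is controlled by the Brownian bridge factorization (`heatKernel_bridge`):
e^{(t-s)Δ}(|·|^{-γ} e^{sΔ}φ) ≤ C (s(t-s)/t)^{-γ/2} e^{tΔ}φ, and Hölder gives the analogue for θ-th
powers. Since f(p) ≤ Ψ H(p)^θ and H'(p) ≤ Φ H(p)^{1-θ}, the powers recombine to 2v. If 2 e^{sΔ}H(w)
≤ A s^{-N/2}, the substitution H(τ) = A s^{-N/2} turns the remaining time integral into the one in
Q, times a multiple of A^{(2-γ)/N} (`lintegral_Ioo_le_lintegral_Ioi`). It remains to make const ·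
A^{(2-γ)/N} Q(η) ≤ 1 for large η. In case (i) L¹_ul smoothing provides some A, and Q → 0. In case
(ii) approximation by BUC makes A arbitrarily small, while Q stays bounded. -/

/-! ### Gaussian identities. -/

theorem heatKernel_nonneg {N : ℕ} (x : E N) {t : ℝ} (ht : 0 < t) : 0 ≤ heatKernel x t := by
  unfold heatKernel; positivity

theorem measurable_heatKernel {N : ℕ} :
    Measurable (fun p : E N × ℝ => heatKernel p.1 p.2) := by
  unfold heatKernel
  fun_prop

theorem lintegral_exp_neg_norm_sq {N : ℕ} {b : ℝ} (hb : 0 < b) :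
    ∫⁻ y : E N, ENNReal.ofReal (Real.exp (-(b * ‖y‖ ^ 2))) =
      ENNReal.ofReal ((Real.pi / b) ^ ((N : ℝ) / 2)) := by
  have h := GaussianFourier.integral_rexp_neg_mul_sq_norm (V := E N) hb
  simp only [finrank_euclideanSpace, Fintype.card_fin, neg_mul] at h
  have hi : Integrable (fun y : E N => Real.exp (-(b * ‖y‖ ^ 2))) := by
    by_contra hn
    rw [integral_undef hn] at h
    have : 0 < (Real.pi / b) ^ ((N : ℝ) / 2) := by positivity
    exact this.ne h
  rw [← h, ofReal_integral_eq_lintegral_ofReal hi (ae_of_all _ fun y => (Real.exp_pos _).le)]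

theorem lintegral_heatKernel {N : ℕ} {t : ℝ} (ht : 0 < t) :
    ∫⁻ y : E N, ENNReal.ofReal (heatKernel y t) = 1 := by
  unfold heatKernel
  have hc : 0 ≤ (4 * Real.pi * t) ^ (-((N : ℝ) / 2)) := by positivity
  simp_rw [ENNReal.ofReal_mul hc]
  rw [lintegral_const_mul _ (by fun_prop)]
  have := lintegral_exp_neg_norm_sq (N := N) (b := 1 / (4 * t)) (by positivity)
  have h2 : ∀ y : E N, ‖y‖ ^ 2 / (4 * t) = 1 / (4 * t) * ‖y‖ ^ 2 := fun y => by ring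
  simp_rw [h2]
  rw [this, ← ENNReal.ofReal_mul hc, ← ENNReal.ofReal_one]
  congr 1
  rw [show Real.pi / (1 / (4 * t)) = 4 * Real.pi * t by field_simp, ← Real.rpow_add (by positivity)]
  simp

theorem heatKernel_neg {N : ℕ} (x : E N) (t : ℝ) : heatKernel (-x) t = heatKernel x t := by
  simp [heatKernel]

theorem lintegral_heatKernel_sub {N : ℕ} {t : ℝ} (ht : 0 < t) (x : E N) :
    ∫⁻ y : E N, ENNReal.ofReal (heatKernel (x - y) t) = 1 := by
  rw [← lintegral_heatKernel (N := N) ht]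
  exact lintegral_sub_left_eq_self (fun y : E N => ENNReal.ofReal (heatKernel y t)) x

/-- Completing the square in y: this is the law at time s of the Brownian bridge from z at time 0 to
x at time t, whose mean interpolates linearly and whose heat-time is s(t-s)/t. -/
theorem heatKernel_bridge {N : ℕ} {s t : ℝ} (hs : 0 < s) (hst : s < t) (x y z : E N) :
    heatKernel (x - y) (t - s) * heatKernel (y - z) s =
      heatKernel (x - z) t *
        heatKernel (y - ((s / t) • x + ((t - s) / t) • z)) (s * (t - s) / t) := by
  have ht : 0 < t := hs.trans hst
  have hts : 0 < t - s := sub_pos.2 hst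
  have e1 : ‖x - y‖ ^ 2 / (4 * (t - s)) + ‖y - z‖ ^ 2 / (4 * s) = ‖x - z‖ ^ 2 / (4 * t) +
      ‖y - ((s / t) • x + ((t - s) / t) • z)‖ ^ 2 / (4 * (s * (t - s) / t)) := by
    simp only [EuclideanSpace.norm_sq_eq, Real.norm_eq_abs, sq_abs, Finset.sum_div,
      ← Finset.sum_add_distrib]
    refine Finset.sum_congr rfl fun i _ => ?_
    simp only [PiLp.sub_apply, PiLp.add_apply, PiLp.smul_apply, smul_eq_mul]
    field_simp
    ring
  have e2 : (4 * Real.pi * (t - s)) ^ (-((N : ℝ) / 2)) * (4 * Real.pi * s) ^ (-((N : ℝ) / 2)) =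
      (4 * Real.pi * t) ^ (-((N : ℝ) / 2)) *
        (4 * Real.pi * (s * (t - s) / t)) ^ (-((N : ℝ) / 2)) := by
    rw [← Real.mul_rpow (by positivity) (by positivity),
      ← Real.mul_rpow (by positivity) (by positivity)]
    congr 1
    field_simp
  unfold heatKernel
  rw [mul_mul_mul_comm, e2, ← Real.exp_add, mul_mul_mul_comm, ← Real.exp_add, ← neg_add, ← neg_add,
    e1]

/-! ### The weight |y|^{-γ} against Gaussians. -/

theorem lintegral_ball_norm_rpow {N : ℕ} (γ : ℝ) {r : ℝ} (hr : 0 < r) :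
    ∫⁻ y in Metric.ball (0 : E N) r, ENNReal.ofReal (‖y‖ ^ (-γ)) =
      ENNReal.ofReal (r ^ ((N : ℝ) - γ)) *
        ∫⁻ y in Metric.ball (0 : E N) 1, ENNReal.ofReal (‖y‖ ^ (-γ)) := by
  have h := Measure.map_addHaar_smul (volume : Measure (E N)) hr.ne'
  have hF : Measurable (fun y : E N => (Metric.ball (0 : E N) r).indicator
      (fun y => ENNReal.ofReal (‖y‖ ^ (-γ))) y) :=
    Measurable.indicator (by fun_prop) measurableSet_ball
  have h1 := lintegral_map (μ := (volume : Measure (E N))) hF (measurable_const_smul r)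
  rw [h, lintegral_smul_measure, lintegral_indicator measurableSet_ball] at h1
  have h2 : ∀ y : E N, (Metric.ball (0 : E N) r).indicator
      (fun y => ENNReal.ofReal (‖y‖ ^ (-γ))) (r • y) = ENNReal.ofReal (r ^ (-γ)) *
      (Metric.ball (0 : E N) 1).indicator (fun y => ENNReal.ofReal (‖y‖ ^ (-γ))) y := by
    intro y
    have hm : r • y ∈ Metric.ball (0 : E N) r ↔ y ∈ Metric.ball (0 : E N) 1 := by
      simp only [mem_ball_zero_iff, norm_smul, Real.norm_eq_abs, abs_of_pos hr]
      constructor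
      · intro h; nlinarith
      · intro h; nlinarith
    by_cases hy : y ∈ Metric.ball (0 : E N) 1
    · rw [indicator_of_mem hy, indicator_of_mem (hm.2 hy), norm_smul, Real.norm_eq_abs,
        abs_of_pos hr, Real.mul_rpow hr.le (norm_nonneg _), ENNReal.ofReal_mul (by positivity)]
    · rw [indicator_of_notMem hy, indicator_of_notMem (fun h => hy (hm.1 h)), mul_zero]
  simp_rw [h2] at h1
  rw [lintegral_const_mul _ (Measurable.indicator (by fun_prop) measurableSet_ball),
    lintegral_indicator measurableSet_ball] at h1
  have h3 : ENNReal.ofReal (r ^ N) * ENNReal.ofReal |(r ^ Module.finrank ℝ (E N))⁻¹| = 1 := by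
    rw [← ENNReal.ofReal_mul (by positivity), finrank_euclideanSpace, Fintype.card_fin,
      abs_of_pos (by positivity), mul_inv_cancel₀ (by positivity), ENNReal.ofReal_one]
  calc _ = ENNReal.ofReal (r ^ N) * (ENNReal.ofReal |(r ^ Module.finrank ℝ (E N))⁻¹| •
        ∫⁻ y in Metric.ball (0 : E N) r, ENNReal.ofReal (‖y‖ ^ (-γ))) := by
        rw [smul_eq_mul, ← mul_assoc, h3, one_mul]
    _ = _ := by
        rw [h1, ← mul_assoc, ← ENNReal.ofReal_mul (by positivity), ← Real.rpow_natCast,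
          ← Real.rpow_add hr, sub_eq_add_neg]

theorem lintegral_ball_norm_rpow_lt_top {N : ℕ} (hN : 1 ≤ N) {γ : ℝ} (hγ : γ < N) :
    ∫⁻ y in Metric.ball (0 : E N) 1, ENNReal.ofReal (‖y‖ ^ (-γ)) < ⊤ := by
  have h : IntegrableOn (fun y : E N => ‖y‖ ^ (-γ)) (Metric.ball 0 1) := by
    refine integrableOn_ball_of_norm_le_rpow (C := 1) (α := γ) (by simpa using hN)
      (by simpa using hγ) (ae_of_all _ fun x => ?_)
      (Measurable.aestronglyMeasurable (by fun_prop))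
    rw [one_mul, Real.norm_of_nonneg (by positivity)]
  have := h.2
  rw [HasFiniteIntegral] at this
  refine lt_of_le_of_lt (lintegral_mono fun y => ?_) this
  rw [Real.enorm_eq_ofReal (by positivity)]

/-- Split at |y| = √τ. Inside, the kernel is at most its maximum and the weight scales; outside, the
weight is at most τ^{-γ/2} and the kernel has mass one. Uniformity in the centre m matters because
the bridge mean depends on both endpoints. -/
theorem exists_lintegral_heatKernel_mul_norm_rpow_le {N : ℕ} (hN : 1 ≤ N) {γ : ℝ} (hγ0 : 0 < γ)
    (hγ : γ < N) : ∃ C : ℝ, 0 < C ∧ ∀ (m : E N) (τ : ℝ), 0 < τ →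
      ∫⁻ y, ENNReal.ofReal (heatKernel (y - m) τ) * ENNReal.ofReal (‖y‖ ^ (-γ)) ≤
        ENNReal.ofReal C * ENNReal.ofReal (τ ^ (-(γ / 2))) := by
  set I : ℝ≥0∞ := ∫⁻ y in Metric.ball (0 : E N) 1, ENNReal.ofReal (‖y‖ ^ (-γ)) with hI
  have hIt : I ≠ ⊤ := (lintegral_ball_norm_rpow_lt_top hN hγ).ne
  refine ⟨(4 * Real.pi) ^ (-((N : ℝ) / 2)) * I.toReal + 1, by positivity, fun m τ hτ => ?_⟩
  have hs : 0 < √τ := Real.sqrt_pos.2 hτ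
  rw [← lintegral_add_compl _ (measurableSet_ball (x := (0 : E N)) (ε := √τ)),
    ENNReal.ofReal_add (by positivity) zero_le_one, add_mul]
  refine add_le_add ?_ ?_
  · calc _ ≤ ∫⁻ y in Metric.ball (0 : E N) √τ,
          ENNReal.ofReal ((4 * Real.pi * τ) ^ (-((N : ℝ) / 2))) * ENNReal.ofReal (‖y‖ ^ (-γ)) := by
          refine lintegral_mono fun y => ?_
          gcongr
          unfold heatKernel
          refine mul_le_of_le_one_right (by positivity) (Real.exp_le_one_iff.2 ?_)
          rw [neg_nonpos]; positivity
      _ = _ := by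
          rw [lintegral_const_mul _ (by fun_prop), lintegral_ball_norm_rpow γ hs, ← hI, ← mul_assoc,
            ENNReal.ofReal_mul (by positivity), ENNReal.ofReal_toReal hIt,
            ← ENNReal.ofReal_mul (by positivity), mul_right_comm _ I, ← ENNReal.ofReal_mul (by positivity)]
          congr 2
          rw [Real.mul_rpow (by positivity) hτ.le, mul_assoc]
          congr 1
          rw [Real.sqrt_eq_rpow, ← Real.rpow_mul hτ.le, ← Real.rpow_add hτ]
          congr 1; ring
  · calc _ ≤ ∫⁻ y in (Metric.ball (0 : E N) √τ)ᶜ,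
          ENNReal.ofReal (heatKernel (y - m) τ) * ENNReal.ofReal (τ ^ (-(γ / 2))) := by
          refine setLIntegral_mono (by
            have := measurable_heatKernel (N := N)
            fun_prop) fun y hy => ?_
          gcongr
          have hy' : √τ ≤ ‖y‖ := by simpa using hy
          calc ‖y‖ ^ (-γ) ≤ √τ ^ (-γ) := Real.rpow_le_rpow_of_nonpos hs hy' (by linarith)
            _ = _ := by
              rw [Real.sqrt_eq_rpow, ← Real.rpow_mul hτ.le]; congr 1; ring
      _ ≤ ∫⁻ y, ENNReal.ofReal (heatKernel (y - m) τ) * ENNReal.ofReal (τ ^ (-(γ / 2))) :=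
          setLIntegral_le_lintegral _ _
      _ = _ := by
          have := measurable_heatKernel (N := N)
          rw [lintegral_mul_const _ (by fun_prop), ENNReal.ofReal_one]
          congr 1
          rw [← lintegral_heatKernel (N := N) hτ]
          exact lintegral_sub_right_eq_self (fun y : E N => ENNReal.ofReal (heatKernel y τ)) m

/-! ### The heat flow and its composition with the weight. -/

theorem measurable_heatFlow {N : ℕ} {α : Type*} [MeasurableSpace α] {τ : α → ℝ} {x : α → E N}
    {φ : α → E N → ℝ≥0∞} (hτ : Measurable τ) (hx : Measurable x)
    (hφ : Measurable (fun p : α × E N => φ p.1 p.2)) :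
    Measurable (fun a => heatFlow (τ a) (φ a) (x a)) := by
  unfold heatFlow
  refine Measurable.lintegral_prod_right' (f := fun p : α × E N =>
    ENNReal.ofReal (heatKernel (x p.1 - p.2) (τ p.1)) * φ p.1 p.2) ?_
  refine Measurable.mul (ENNReal.measurable_ofReal.comp ?_) hφ
  exact measurable_heatKernel.comp (f := fun p : α × E N => (x p.1 - p.2, τ p.1)) (by fun_prop)

theorem heatFlow_mono {N : ℕ} {t : ℝ} {φ ψ : E N → ℝ≥0∞} (h : ∀ᵐ y, φ y ≤ ψ y) (x : E N) :
    heatFlow t φ x ≤ heatFlow t ψ x := by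
  refine lintegral_mono_ae (h.mono fun y hy => ?_)
  gcongr

theorem heatFlow_const {N : ℕ} {t : ℝ} (ht : 0 < t) (c : ℝ≥0∞) (x : E N) :
    heatFlow t (fun _ => c) x = c := by
  have := measurable_heatKernel (N := N)
  unfold heatFlow
  rw [lintegral_mul_const _ (by fun_prop), lintegral_heatKernel_sub ht, one_mul]

theorem heatFlow_add {N : ℕ} (t : ℝ) {φ : E N → ℝ≥0∞} (hφ : AEMeasurable φ) (ψ : E N → ℝ≥0∞)
    (x : E N) : heatFlow t (fun y => φ y + ψ y) x = heatFlow t φ x + heatFlow t ψ x := by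
  have := measurable_heatKernel (N := N)
  unfold heatFlow
  simp_rw [mul_add]
  exact lintegral_add_left' (AEMeasurable.mul (by fun_prop) hφ) _

theorem heatFlow_const_mul {N : ℕ} (t : ℝ) (c : ℝ≥0∞) {φ : E N → ℝ≥0∞} (hφ : Measurable φ)
    (x : E N) : heatFlow t (fun y => c * φ y) x = c * heatFlow t φ x := by
  have := measurable_heatKernel (N := N)
  unfold heatFlow
  simp_rw [mul_left_comm _ c]
  rw [lintegral_const_mul _ (by fun_prop)]

/-- After Tonelli and the bridge identity, the inner integral is the weight against a single
Gaussian of heat-time s(t-s)/t, bounded uniformly in its centre by `hC`. -/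
theorem heatFlow_norm_rpow_mul_heatFlow_le {N : ℕ} {γ C : ℝ}
    (hC : ∀ (m : E N) (τ : ℝ), 0 < τ →
      ∫⁻ y, ENNReal.ofReal (heatKernel (y - m) τ) * ENNReal.ofReal (‖y‖ ^ (-γ)) ≤
        ENNReal.ofReal C * ENNReal.ofReal (τ ^ (-(γ / 2))))
    {s t : ℝ} (hs : 0 < s) (hst : s < t) {φ : E N → ℝ≥0∞} (hφ : Measurable φ) (x : E N) :
    heatFlow (t - s) (fun y => ENNReal.ofReal (‖y‖ ^ (-γ)) * heatFlow s φ y) x ≤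
      ENNReal.ofReal C * ENNReal.ofReal ((s * (t - s) / t) ^ (-(γ / 2))) * heatFlow t φ x := by
  have ht : 0 < t := hs.trans hst
  have hts : 0 < t - s := sub_pos.2 hst
  have hk := measurable_heatKernel (N := N)
  unfold heatFlow
  calc _ = ∫⁻ y, ∫⁻ z, ENNReal.ofReal (heatKernel (x - y) (t - s)) *
        (ENNReal.ofReal (‖y‖ ^ (-γ)) * (ENNReal.ofReal (heatKernel (y - z) s) * φ z)) := by
        refine lintegral_congr fun y => ?_
        rw [lintegral_const_mul' _ _ ENNReal.ofReal_ne_top,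
          lintegral_const_mul' _ _ ENNReal.ofReal_ne_top]
    _ = ∫⁻ z, ∫⁻ y, ENNReal.ofReal (heatKernel (x - y) (t - s)) *
        (ENNReal.ofReal (‖y‖ ^ (-γ)) * (ENNReal.ofReal (heatKernel (y - z) s) * φ z)) := by
        refine lintegral_lintegral_swap (Measurable.aemeasurable ?_)
        simp only [Function.uncurry_def]
        fun_prop
    _ = ∫⁻ z, (∫⁻ y, ENNReal.ofReal
          (heatKernel (y - ((s / t) • x + ((t - s) / t) • z)) (s * (t - s) / t)) *
          ENNReal.ofReal (‖y‖ ^ (-γ))) * (ENNReal.ofReal (heatKernel (x - z) t) * φ z) := by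
        refine lintegral_congr fun z => ?_
        rw [← lintegral_mul_const _ (by fun_prop)]
        refine lintegral_congr fun y => ?_
        calc _ = ENNReal.ofReal (heatKernel (x - y) (t - s)) *
              ENNReal.ofReal (heatKernel (y - z) s) * (ENNReal.ofReal (‖y‖ ^ (-γ)) * φ z) := by
              ring
          _ = _ := by
              rw [← ENNReal.ofReal_mul (heatKernel_nonneg _ hts), heatKernel_bridge hs hst,
                ENNReal.ofReal_mul (heatKernel_nonneg _ ht)]
              ring
    _ ≤ ∫⁻ z, ENNReal.ofReal C * ENNReal.ofReal ((s * (t - s) / t) ^ (-(γ / 2))) *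
          (ENNReal.ofReal (heatKernel (x - z) t) * φ z) := by
        refine lintegral_mono fun z => ?_
        gcongr
        exact hC _ _ (by positivity)
    _ = _ := by rw [lintegral_const_mul _ (by fun_prop)]

/-- The endpoint θ = 0. The natural bound (t-s)^{-γ/2} is weakened, using s(t-s)/t ≤ t-s, so that it
shares its constant with the endpoint θ = 1. -/
theorem lintegral_heatKernel_sub_mul_norm_rpow_le {N : ℕ} {γ C : ℝ} (hγ : 0 < γ)
    (hC : ∀ (m : E N) (τ : ℝ), 0 < τ →
      ∫⁻ y, ENNReal.ofReal (heatKernel (y - m) τ) * ENNReal.ofReal (‖y‖ ^ (-γ)) ≤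
        ENNReal.ofReal C * ENNReal.ofReal (τ ^ (-(γ / 2))))
    {s t : ℝ} (hs : 0 < s) (hst : s < t) (x : E N) :
    heatFlow (t - s) (fun y => ENNReal.ofReal (‖y‖ ^ (-γ))) x ≤
      ENNReal.ofReal C * ENNReal.ofReal ((s * (t - s) / t) ^ (-(γ / 2))) := by
  have ht : 0 < t := hs.trans hst
  have hts : 0 < t - s := sub_pos.2 hst
  refine le_trans (le_of_eq (lintegral_congr fun y => ?_)) ((hC x (t - s) hts).trans ?_)
  · rw [← heatKernel_neg, neg_sub]
  · refine mul_le_mul_right (ENNReal.ofReal_le_ofReal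
      (Real.rpow_le_rpow_of_nonpos (by positivity) ?_ (by linarith))) _
    rw [div_le_iff₀ ht]
    nlinarith

/-- Hölder with weights 1-θ and θ between the two endpoint bounds, whose common constant `B`
recombines as B^{1-θ} B^θ. -/
theorem heatFlow_norm_rpow_mul_heatFlow_rpow_le {N : ℕ} {γ C θ : ℝ} (hγ : 0 < γ)
    (hC : ∀ (m : E N) (τ : ℝ), 0 < τ →
      ∫⁻ y, ENNReal.ofReal (heatKernel (y - m) τ) * ENNReal.ofReal (‖y‖ ^ (-γ)) ≤
        ENNReal.ofReal C * ENNReal.ofReal (τ ^ (-(γ / 2))))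
    (hθ : 0 < θ) (hθ1 : θ ≤ 1)
    {s t : ℝ} (hs : 0 < s) (hst : s < t) {φ : E N → ℝ≥0∞} (hφ : Measurable φ) (x : E N) :
    heatFlow (t - s) (fun y => ENNReal.ofReal (‖y‖ ^ (-γ)) * heatFlow s φ y ^ θ) x ≤
      ENNReal.ofReal C * ENNReal.ofReal ((s * (t - s) / t) ^ (-(γ / 2))) *
        heatFlow t φ x ^ θ := by
  have hk := measurable_heatKernel (N := N)
  have hv : Measurable (fun y => heatFlow s φ y) :=
    measurable_heatFlow (τ := fun _ => s) (x := fun y => y) (φ := fun _ => φ) (by fun_prop)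
      (by fun_prop) (by fun_prop)
  have h1 := heatFlow_norm_rpow_mul_heatFlow_le hC hs hst hφ x
  have h2 := lintegral_heatKernel_sub_mul_norm_rpow_le hγ hC hs hst x
  set B := ENNReal.ofReal C * ENNReal.ofReal ((s * (t - s) / t) ^ (-(γ / 2))) with hB
  unfold heatFlow at h1 h2
  have h3 := ENNReal.lintegral_mul_norm_pow_le (μ := (volume : Measure (E N)))
    (f := fun y => ENNReal.ofReal (heatKernel (x - y) (t - s)) * ENNReal.ofReal (‖y‖ ^ (-γ)))
    (g := fun y => ENNReal.ofReal (heatKernel (x - y) (t - s)) *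
      (ENNReal.ofReal (‖y‖ ^ (-γ)) * heatFlow s φ y))
    (by fun_prop) (by fun_prop) (sub_nonneg.2 hθ1) hθ.le (sub_add_cancel 1 θ)
  calc _ = _ := lintegral_congr fun y => ?_
    _ ≤ _ := h3
    _ ≤ B ^ (1 - θ) * (B * heatFlow t φ x) ^ θ := by
      refine mul_le_mul' (ENNReal.rpow_le_rpow h2 (by linarith)) (ENNReal.rpow_le_rpow h1 hθ.le)
    _ = _ := by
      rw [ENNReal.mul_rpow_of_nonneg _ _ hθ.le, ← mul_assoc, ← ENNReal.rpow_add_of_nonneg _ _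
        (by linarith) hθ.le, sub_add_cancel, ENNReal.rpow_one]
  rw [← mul_assoc, ← mul_assoc, ENNReal.mul_rpow_of_nonneg _ (heatFlow s φ y) hθ.le, ← mul_assoc,
    ← ENNReal.rpow_add_of_nonneg _ _ (by linarith) hθ.le, sub_add_cancel, ENNReal.rpow_one]

/-! ### Uniformly local estimates for the heat flow. -/

/-- The smoothing estimate `‖e^{tΔ}φ‖_∞ ≤ K t^{-N/2} ‖φ‖_{L¹_ul}` for `0 < t ≤ 1`. -/
theorem exists_heatFlow_le_rpow_mul (N : ℕ) : ∃ K : ℝ, 0 < K ∧ ∀ (φ : E N → ℝ≥0∞),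
    AEMeasurable φ → ∀ M : ℝ≥0∞, (∀ y, ∫⁻ x in Metric.ball y 1, φ x ≤ M) →
    ∀ t : ℝ, 0 < t → t ≤ 1 → ∀ x, heatFlow t φ x ≤ ENNReal.ofReal (K * t ^ (-((N : ℝ) / 2))) * M := by
  have hV0 : volume (Metric.ball (0 : E N) 1) ≠ 0 :=
    (Metric.measure_ball_pos _ _ one_pos).ne'
  have hVt : volume (Metric.ball (0 : E N) 1) ≠ ⊤ := measure_ball_lt_top.ne
  set V := (volume (Metric.ball (0 : E N) 1)).toReal with hV
  have hVp : 0 < V := ENNReal.toReal_pos hV0 hVt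
  have hVe : ENNReal.ofReal V = volume (Metric.ball (0 : E N) 1) := ENNReal.ofReal_toReal hVt
  set I : ℝ := (Real.pi / (1 / 8)) ^ ((N : ℝ) / 2) with hI
  refine ⟨(4 * Real.pi) ^ (-((N : ℝ) / 2)) * (Real.exp (1 / 4) * V⁻¹ * I), by positivity,
    fun φ hφ M hM t ht ht1 x => ?_⟩
  -- As t ≤ 1, the exponential is at most exp(-|x-y|²/4). For |y-z| < 1, |x-z|² ≤ 2|x-y|² + 2, which
  -- explains the rate 1/8 and the loss exp(1/4); averaging over the ball divides by its volume.
  have hpt : ∀ y : E N, ENNReal.ofReal (heatKernel (x - y) t) ≤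
      ENNReal.ofReal ((4 * Real.pi) ^ (-((N : ℝ) / 2)) * t ^ (-((N : ℝ) / 2)) *
        (Real.exp (1 / 4) * V⁻¹)) *
      ∫⁻ z in Metric.ball y 1, ENNReal.ofReal (Real.exp (-(1 / 8 * ‖x - z‖ ^ 2))) := by
    intro y
    have h1 : ∫⁻ z in Metric.ball y 1, ENNReal.ofReal (Real.exp (-(1 / 4) - ‖x - y‖ ^ 2 / 4)) ≤
        ∫⁻ z in Metric.ball y 1, ENNReal.ofReal (Real.exp (-(1 / 8 * ‖x - z‖ ^ 2))) := by
      refine setLIntegral_mono (by fun_prop) fun z hz => ?_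
      gcongr
      have h2 : ‖x - z‖ ≤ ‖x - y‖ + 1 := by
        have h3 : ‖y - z‖ < 1 := by rw [← dist_eq_norm, dist_comm]; exact hz
        calc ‖x - z‖ = ‖(x - y) + (y - z)‖ := by congr 1; abel
          _ ≤ ‖x - y‖ + ‖y - z‖ := norm_add_le _ _
          _ ≤ _ := by linarith
      nlinarith [sq_nonneg (‖x - y‖ - 1), norm_nonneg (x - z), norm_nonneg (x - y)]
    rw [setLIntegral_const, Measure.addHaar_ball_center, ← hVe] at h1
    refine le_trans ?_ (mul_le_mul_right h1 _)
    rw [← ENNReal.ofReal_mul (by positivity), ← ENNReal.ofReal_mul (by positivity)]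
    refine ENNReal.ofReal_le_ofReal ?_
    have h4 : Real.exp (1 / 4) * Real.exp (-(1 / 4) - ‖x - y‖ ^ 2 / 4) =
        Real.exp (-(‖x - y‖ ^ 2 / 4)) := by
      rw [← Real.exp_add]; congr 1; ring
    calc heatKernel (x - y) t ≤ (4 * Real.pi) ^ (-((N : ℝ) / 2)) * t ^ (-((N : ℝ) / 2)) *
          Real.exp (-(‖x - y‖ ^ 2 / 4)) := by
          unfold heatKernel
          rw [Real.mul_rpow (by positivity) ht.le]
          gcongr
          linarith
      _ = _ := by rw [← h4]; field_simp
  have hI2 : ∫⁻ z : E N, ENNReal.ofReal (Real.exp (-(1 / 8 * ‖x - z‖ ^ 2))) = ENNReal.ofReal I := by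
    rw [hI, ← lintegral_exp_neg_norm_sq (N := N) (b := 1 / 8) (by norm_num)]
    exact lintegral_sub_left_eq_self
      (fun y : E N => ENNReal.ofReal (Real.exp (-(1 / 8 * ‖y‖ ^ 2)))) x
  -- The relation |y-z| < 1 is symmetric, so Tonelli moves the ball average from the Gaussian onto
  -- φ.
  have hswap : ∫⁻ y, (∫⁻ z in Metric.ball y 1,
      ENNReal.ofReal (Real.exp (-(1 / 8 * ‖x - z‖ ^ 2)))) * φ y =
      ∫⁻ z, ENNReal.ofReal (Real.exp (-(1 / 8 * ‖x - z‖ ^ 2))) *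
        ∫⁻ y in Metric.ball z 1, φ y := by
    have hm : MeasurableSet {p : E N × E N | dist p.1 p.2 < 1} :=
      (isOpen_lt (by fun_prop) (by fun_prop)).measurableSet
    calc _ = ∫⁻ y, ∫⁻ z, {p : E N × E N | dist p.1 p.2 < 1}.indicator
          (fun p => ENNReal.ofReal (Real.exp (-(1 / 8 * ‖x - p.2‖ ^ 2))) * φ p.1) (y, z) := by
          refine lintegral_congr fun y => ?_
          rw [← lintegral_mul_const _ (by fun_prop), ← lintegral_indicator measurableSet_ball]
          refine lintegral_congr fun z => ?_
          simp only [indicator, Metric.mem_ball, mem_ofPred_eq, dist_comm]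
      _ = ∫⁻ z, ∫⁻ y, {p : E N × E N | dist p.1 p.2 < 1}.indicator
          (fun p => ENNReal.ofReal (Real.exp (-(1 / 8 * ‖x - p.2‖ ^ 2))) * φ p.1) (y, z) := by
          refine lintegral_lintegral_swap ?_
          refine AEMeasurable.indicator ?_ hm
          exact AEMeasurable.mul (by fun_prop) hφ.comp_fst
      _ = _ := by
          refine lintegral_congr fun z => ?_
          rw [← lintegral_const_mul' _ _ ENNReal.ofReal_ne_top,
            ← lintegral_indicator measurableSet_ball]
          refine lintegral_congr fun y => ?_
          simp only [indicator, Metric.mem_ball, mem_ofPred_eq]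
  calc heatFlow t φ x ≤ ∫⁻ y, ENNReal.ofReal ((4 * Real.pi) ^ (-((N : ℝ) / 2)) *
        t ^ (-((N : ℝ) / 2)) * (Real.exp (1 / 4) * V⁻¹)) *
        ((∫⁻ z in Metric.ball y 1, ENNReal.ofReal (Real.exp (-(1 / 8 * ‖x - z‖ ^ 2)))) * φ y) := by
        refine lintegral_mono fun y => ?_
        rw [← mul_assoc]
        gcongr
        exact hpt y
    _ ≤ ENNReal.ofReal ((4 * Real.pi) ^ (-((N : ℝ) / 2)) *
        t ^ (-((N : ℝ) / 2)) * (Real.exp (1 / 4) * V⁻¹)) *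
        ∫⁻ z, ENNReal.ofReal (Real.exp (-(1 / 8 * ‖x - z‖ ^ 2))) * M := by
        rw [lintegral_const_mul' _ _ ENNReal.ofReal_ne_top, hswap]
        gcongr with z
        exact hM z
    _ = _ := by
        rw [lintegral_mul_const _ (by fun_prop), hI2, ← mul_assoc,
          ← ENNReal.ofReal_mul (by positivity)]
        congr 2
        ring

/-- The heat flow is an average of translates with total mass one, and the bound on balls is
translation invariant. -/
theorem setLIntegral_ball_heatFlow_le {N : ℕ} {φ : E N → ℝ≥0∞} (hφ : Measurable φ) {M : ℝ≥0∞}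
    (hM : ∀ y, ∫⁻ x in Metric.ball y 1, φ x ≤ M) {t : ℝ} (ht : 0 < t) (y : E N) :
    ∫⁻ x in Metric.ball y 1, heatFlow t φ x ≤ M := by
  have hk := measurable_heatKernel (N := N)
  have h1 : ∀ x : E N, heatFlow t φ x = ∫⁻ w, ENNReal.ofReal (heatKernel w t) * φ (x - w) := by
    intro x
    have := lintegral_sub_left_eq_self (μ := (volume : Measure (E N)))
      (fun w : E N => ENNReal.ofReal (heatKernel w t) * φ (x - w)) x
    simp only [sub_sub_cancel] at this
    exact this
  simp_rw [h1]
  rw [lintegral_lintegral_swap (Measurable.aemeasurable (by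
    simp only [Function.uncurry_def]; fun_prop))]
  calc _ ≤ ∫⁻ w : E N, ENNReal.ofReal (heatKernel w t) * M := by
        refine lintegral_mono fun w => ?_
        rw [lintegral_const_mul _ (by fun_prop)]
        gcongr
        refine le_trans (le_of_eq ?_) (hM (y - w))
        rw [← lintegral_indicator measurableSet_ball, ← lintegral_indicator measurableSet_ball]
        rw [← lintegral_sub_right_eq_self (μ := (volume : Measure (E N)))
          ((Metric.ball (y - w) 1).indicator φ) w]
        refine lintegral_congr fun x => ?_
        simp only [indicator, Metric.mem_ball, dist_sub_right]
    _ = M := by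
        rw [lintegral_mul_const _ (by fun_prop), lintegral_heatKernel ht, one_mul]

/-! ### The Duhamel operator and monotone iteration. -/

/-- The right-hand side of the integral equation, as an operator on `[0,∞]`-valued functions. -/
def duhamel {N : ℕ} (γ : ℝ) (g : ℝ → ℝ) (w : E N → ℝ≥0∞) (U : E N → ℝ → ℝ≥0∞) (x : E N) (t : ℝ) :
    ℝ≥0∞ :=
  heatFlow t w x + ∫⁻ s in Ioo (0 : ℝ) t,
    heatFlow (t - s) (fun y => ENNReal.ofReal (‖y‖ ^ (-γ) * g (U y s).toReal)) x

theorem measurable_heatFlow_source {N : ℕ} (γ : ℝ) {g : ℝ → ℝ} (hg : Measurable g)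
    {U : E N → ℝ → ℝ≥0∞} (hU : Measurable (fun p : E N × ℝ => U p.1 p.2)) :
    Measurable (fun q : (E N × ℝ) × ℝ => heatFlow (q.1.2 - q.2)
      (fun y => ENNReal.ofReal (‖y‖ ^ (-γ) * g (U y q.2).toReal)) q.1.1) := by
  refine measurable_heatFlow (τ := fun q : (E N × ℝ) × ℝ => q.1.2 - q.2)
    (x := fun q => q.1.1)
    (φ := fun q y => ENNReal.ofReal (‖y‖ ^ (-γ) * g (U y q.2).toReal))
    (by fun_prop) (by fun_prop) ?_
  refine ENNReal.measurable_ofReal.comp (Measurable.mul (by fun_prop) (hg.comp ?_))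
  exact (hU.comp (f := fun p : ((E N × ℝ) × ℝ) × E N => (p.2, p.1.2)) (by fun_prop)).ennreal_toReal

theorem measurable_duhamel {N : ℕ} (γ : ℝ) {g : ℝ → ℝ} (hg : Measurable g) {w : E N → ℝ≥0∞}
    (hw : Measurable w) {U : E N → ℝ → ℝ≥0∞} (hU : Measurable (fun p : E N × ℝ => U p.1 p.2)) :
    Measurable (fun p : E N × ℝ => duhamel γ g w U p.1 p.2) := by
  unfold duhamel
  refine Measurable.add (measurable_heatFlow (τ := fun p : E N × ℝ => p.2)
    (x := fun p : E N × ℝ => p.1) (φ := fun _ => w) (by fun_prop) (by fun_prop) (by fun_prop)) ?_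
  have h : ∀ p : E N × ℝ, ∫⁻ s in Ioo (0 : ℝ) p.2,
      heatFlow (p.2 - s) (fun y => ENNReal.ofReal (‖y‖ ^ (-γ) * g (U y s).toReal)) p.1 =
      ∫⁻ s, {q : (E N × ℝ) × ℝ | 0 < q.2 ∧ q.2 < q.1.2}.indicator (fun q => heatFlow (q.1.2 - q.2)
        (fun y => ENNReal.ofReal (‖y‖ ^ (-γ) * g (U y q.2).toReal)) q.1.1) (p, s) := by
    intro p
    rw [← lintegral_indicator measurableSet_Ioo]
    rfl
  simp_rw [h]
  refine Measurable.lintegral_prod_right' (Measurable.indicator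
    (measurable_heatFlow_source γ hg hU) ?_)
  exact (measurableSet_lt measurable_const measurable_snd).inter
    (measurableSet_lt measurable_snd measurable_fst.snd)

/-- Finiteness of V is essential: `toReal` sends ∞ to 0, so it is monotone only below finite values.
-/
theorem duhamel_mono {N : ℕ} {γ : ℝ} {g : ℝ → ℝ} (hg : Monotone g) {w : E N → ℝ≥0∞}
    {U V : E N → ℝ → ℝ≥0∞} {T : ℝ} (hV : ∀ t ∈ Ioo 0 T, ∀ x, V x t < ⊤)
    (hUV : ∀ t ∈ Ioo 0 T, ∀ x, U x t ≤ V x t) {t : ℝ} (ht : t ∈ Ioo 0 T) (x : E N) :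
    duhamel γ g w U x t ≤ duhamel γ g w V x t := by
  unfold duhamel
  refine add_le_add_right (setLIntegral_mono' measurableSet_Ioo fun s hs => ?_) _
  refine heatFlow_mono (ae_of_all _ fun y => ?_) x
  have hs' : s ∈ Ioo 0 T := ⟨hs.1, hs.2.trans ht.2⟩
  refine ENNReal.ofReal_le_ofReal (mul_le_mul_of_nonneg_left (hg ?_) (by positivity))
  exact ENNReal.toReal_mono (hV s hs' y).ne (hUV s hs' y)

/-- Monotone iteration below a supersolution. -/
theorem exists_fixed_point_duhamel_le {N : ℕ} {γ : ℝ} {g : ℝ → ℝ} (hg : Monotone g)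
    (hgc : Continuous g) {w : E N → ℝ≥0∞} (hw : Measurable w) {V : E N → ℝ → ℝ≥0∞} {T : ℝ}
    (hV : ∀ t ∈ Ioo 0 T, ∀ x, V x t < ⊤)
    (hsup : ∀ t ∈ Ioo 0 T, ∀ x, duhamel γ g w V x t ≤ V x t) :
    ∃ U : E N → ℝ → ℝ≥0∞, Measurable (fun p : E N × ℝ => U p.1 p.2) ∧
      (∀ t ∈ Ioo 0 T, ∀ x, U x t ≤ V x t) ∧
      ∀ t ∈ Ioo 0 T, ∀ x, U x t = duhamel γ g w U x t := by
  set S : ℕ → E N → ℝ → ℝ≥0∞ := fun n => (duhamel γ g w)^[n] (fun _ _ => 0) with hS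
  have hS0 : S 0 = fun _ _ => 0 := rfl
  have hS1 : ∀ n, S (n + 1) = duhamel γ g w (S n) := fun n => by
    simp only [hS, Function.iterate_succ_apply']
  have hSm : ∀ n, Measurable (fun p : E N × ℝ => S n p.1 p.2) := by
    intro n
    induction n with
    | zero => rw [hS0]; exact measurable_const
    | succ n ih => rw [hS1]; exact measurable_duhamel γ hgc.measurable hw ih
  have hSV : ∀ n, ∀ t ∈ Ioo 0 T, ∀ x, S n x t ≤ V x t := by
    intro n
    induction n with
    | zero => intro t _ x; rw [hS0]; exact zero_le
    | succ n ih =>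
      intro t ht x
      rw [hS1]
      exact (duhamel_mono hg hV ih ht x).trans (hsup t ht x)
  have hSt : ∀ n, ∀ t ∈ Ioo 0 T, ∀ x, S n x t < ⊤ := fun n t ht x =>
    (hSV n t ht x).trans_lt (hV t ht x)
  have hSs : ∀ n, ∀ t ∈ Ioo 0 T, ∀ x, S n x t ≤ S (n + 1) x t := by
    intro n
    induction n with
    | zero => intro t _ x; rw [hS0]; exact zero_le
    | succ n ih =>
      intro t ht x
      rw [hS1, hS1 (n + 1)]
      exact duhamel_mono hg (hSt (n + 1)) ih ht x
  have hSmono : ∀ t ∈ Ioo 0 T, ∀ x, Monotone (fun n => S n x t) := fun t ht x =>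
    monotone_nat_of_le_succ fun n => hSs n t ht x
  have hlim : ∀ t ∈ Ioo 0 T, ∀ x, Tendsto (fun n => S n x t) atTop (𝓝 (⨆ n, S n x t)) :=
    fun t ht x => tendsto_atTop_iSup (hSmono t ht x)
  have hUV : ∀ t ∈ Ioo 0 T, ∀ x, ⨆ n, S n x t ≤ V x t := fun t ht x =>
    iSup_le fun n => hSV n t ht x
  refine ⟨fun x t => ⨆ n, S n x t, Measurable.iSup hSm, hUV, fun t ht x => ?_⟩
  -- The shifted iterates converge to the supremum; monotone convergence in time and then in space,
  -- with continuity of g, shows that they also converge to its Duhamel image.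
  refine tendsto_nhds_unique ((tendsto_add_atTop_iff_nat 1).2 (hlim t ht x)) ?_
  simp_rw [hS1]
  unfold duhamel
  refine tendsto_const_nhds.add ?_
  refine lintegral_tendsto_of_tendsto_of_monotone (fun n => ?_) ?_ ?_
  · exact ((measurable_heatFlow_source γ hgc.measurable (hSm n)).comp
      (f := fun s : ℝ => ((x, t), s)) (by fun_prop)).aemeasurable
  · refine ae_restrict_of_forall_mem measurableSet_Ioo fun s hs => fun m n hmn => ?_
    have hs' : s ∈ Ioo 0 T := ⟨hs.1, hs.2.trans ht.2⟩
    refine heatFlow_mono (ae_of_all _ fun y => ?_) x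
    refine ENNReal.ofReal_le_ofReal (mul_le_mul_of_nonneg_left (hg ?_) (by positivity))
    exact ENNReal.toReal_mono (hSt n s hs' y).ne (hSmono s hs' y hmn)
  · refine ae_restrict_of_forall_mem measurableSet_Ioo fun s hs => ?_
    have hs' : s ∈ Ioo 0 T := ⟨hs.1, hs.2.trans ht.2⟩
    have hk := measurable_heatKernel (N := N)
    unfold heatFlow
    refine lintegral_tendsto_of_tendsto_of_monotone (fun n => ?_) ?_ ?_
    · refine Measurable.aemeasurable (Measurable.mul (by fun_prop)
        (ENNReal.measurable_ofReal.comp (Measurable.mul (by fun_prop) (hgc.measurable.comp ?_))))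
      exact ((hSm n).comp (f := fun y : E N => (y, s)) (by fun_prop)).ennreal_toReal
    · refine ae_of_all _ fun y m n hmn => ?_
      refine mul_le_mul_right (ENNReal.ofReal_le_ofReal
        (mul_le_mul_of_nonneg_left (hg ?_) (by positivity))) _
      exact ENNReal.toReal_mono (hSt n s hs' y).ne (hSmono s hs' y hmn)
    · refine ae_of_all _ fun y => ?_
      refine ENNReal.Tendsto.const_mul ?_ (Or.inr ENNReal.ofReal_ne_top)
      refine ENNReal.tendsto_ofReal (Tendsto.const_mul _ ((hgc.tendsto _).comp ?_))
      exact (ENNReal.tendsto_toReal ((hUV s hs' y).trans_lt (hV s hs' y)).ne).comp (hlim s hs' y)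

/-! ### Monotonicity, tangents and inversion of H. -/

namespace CondH

variable {H : ℝ → ℝ}

theorem hasDerivAt (hH : CondH H) {ξ : ℝ} (hξ : 0 < ξ) : HasDerivAt H (D H ξ) ξ :=
  ((hH.contDiff.differentiableOn (by norm_num)) ξ hξ.le).hasDerivWithinAt.hasDerivAt
    (Ici_mem_nhds hξ)

theorem continuousOn (hH : CondH H) : ContinuousOn H (Ici 0) := hH.contDiff.continuousOn

theorem strictMonoOn (hH : CondH H) : StrictMonoOn H (Ici 0) := by
  refine strictMonoOn_of_deriv_pos (convex_Ici 0) hH.continuousOn fun ξ hξ => ?_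
  rw [interior_Ici] at hξ
  rw [(hH.hasDerivAt hξ).deriv]
  exact hH.deriv_pos ξ hξ

theorem nonneg (hH : CondH H) {ξ : ℝ} (hξ : 0 ≤ ξ) : 0 ≤ H ξ := by
  have h0 : Tendsto H (𝓝[>] 0) (𝓝 (H 0)) :=
    (hH.continuousOn 0 self_mem_Ici).mono_left (nhdsWithin_mono _ Ioi_subset_Ici_self)
  have h1 : 0 ≤ H 0 := ge_of_tendsto h0 (eventually_nhdsWithin_of_forall fun y hy => (hH.pos y hy).le)
  exact h1.trans (hH.strictMonoOn.monotoneOn self_mem_Ici hξ hξ)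

/-- Mean value theorem on either side of w; convexity is available only beyond R, hence both points
lie there. -/
theorem tangent_le (hH : CondH H) {R : ℝ} (hR0 : 0 < R) (hR : MonotoneOn (D H) (Ici R)) {w y : ℝ}
    (hw : R ≤ w) (hy : R ≤ y) : H w + D H w * (y - w) ≤ H y := by
  rcases lt_trichotomy w y with h | h | h
  · obtain ⟨c, hc, hc'⟩ := exists_hasDerivAt_eq_slope H (D H) h
      (hH.continuousOn.mono fun z hz => (hR0.le.trans hw).trans hz.1)
      fun z hz => hH.hasDerivAt (hR0.trans_le (hw.trans hz.1.le))
    rw [eq_div_iff (sub_pos.2 h).ne'] at hc'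
    have := hR hw (hw.trans hc.1.le) hc.1.le
    nlinarith
  · simp [h]
  · obtain ⟨c, hc, hc'⟩ := exists_hasDerivAt_eq_slope H (D H) h
      (hH.continuousOn.mono fun z hz => (hR0.le.trans hy).trans hz.1)
      fun z hz => hH.hasDerivAt (hR0.trans_le (hy.trans hz.1.le))
    rw [eq_div_iff (sub_pos.2 h).ne'] at hc'
    have := hR (mem_Ici.2 (hy.trans hc.1.le)) hw hc.2.le
    nlinarith

/-- A pointwise choice suffices for H⁻¹: the supersolution need not be measurable, since
measurability of the solution comes from the iterates. -/
theorem exists_rightInverse (hH : CondH H) {R : ℝ} (hR : 0 < R) :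
    ∃ J : ℝ → ℝ, ∀ z, H R ≤ z → R ≤ J z ∧ H (J z) = z := by
  have h : ∀ z, ∃ y, H R ≤ z → R ≤ y ∧ H y = z := by
    intro z
    by_cases hz : H R ≤ z
    · obtain ⟨b, hb, hbR⟩ := ((hH.tendsto.eventually_ge_atTop z).and (eventually_ge_atTop R)).exists
      obtain ⟨y, hy, hyz⟩ := intermediate_value_Icc hbR
        (hH.continuousOn.mono fun x hx => hR.le.trans hx.1) ⟨hz, hb⟩
      exact ⟨y, fun _ => ⟨hy.1, hyz⟩⟩
    · exact ⟨0, fun h => absurd h hz⟩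
  choose J hJ using h
  exact ⟨J, hJ⟩

end CondH

/-! ### The suprema Φ, Ψ and the quantity Q. -/

theorem div_le_Phi (H : ℝ → ℝ) (θ : ℝ) {ζ ξ σ : ℝ} (hσ : σ ∈ Icc ζ ξ) :
    ENNReal.ofReal (D H σ) / ENNReal.ofReal (H σ) ^ (1 - θ) ≤ Phi H θ ζ ξ :=
  le_iSup₂ (f := fun σ (_ : σ ∈ Icc ζ ξ) =>
    ENNReal.ofReal (D H σ) / ENNReal.ofReal (H σ) ^ (1 - θ)) σ hσ

theorem div_le_Psi (f H : ℝ → ℝ) (θ : ℝ) {ζ ξ σ : ℝ} (hσ : σ ∈ Icc ζ ξ) :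
    ENNReal.ofReal (f σ) / ENNReal.ofReal (H σ) ^ θ ≤ Psi f H θ ζ ξ :=
  le_iSup₂ (f := fun σ (_ : σ ∈ Icc ζ ξ) =>
    ENNReal.ofReal (f σ) / ENNReal.ofReal (H σ) ^ θ) σ hσ

/-- For κ ≥ 1 and p ≤ 1, κ^p ≤ κ, so a single constant serves both exponents θ and 1-θ. -/
theorem div_rpow_le_mul_div_rpow {d d' a b κ : ℝ≥0∞} (hd : d ≤ d') (hκ : 1 ≤ κ) (hκt : κ ≠ ⊤)
    (hb : b ≤ κ * a) {p : ℝ} (hp : 0 ≤ p) (hp1 : p ≤ 1) : d / a ^ p ≤ κ * (d' / b ^ p) := by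
  have h1 : b ^ p ≤ κ * a ^ p := by
    refine (ENNReal.rpow_le_rpow hb hp).trans ?_
    rw [ENNReal.mul_rpow_of_nonneg _ _ hp]
    gcongr
    simpa using ENNReal.rpow_le_rpow_of_exponent_le hκ hp1
  have hκ0 : κ ≠ 0 := (zero_lt_one.trans_le hκ).ne'
  calc d / a ^ p = κ * (d * (κ * a ^ p)⁻¹) := by
        rw [ENNReal.mul_inv (Or.inl hκ0) (Or.inl hκt), mul_left_comm d, ← mul_assoc,
          ENNReal.mul_inv_cancel hκ0 hκt, one_mul, div_eq_mul_inv]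
    _ ≤ κ * (d' * (b ^ p)⁻¹) := by gcongr
    _ = _ := by rw [div_eq_mul_inv]

/-- Changing the lower endpoint of the suprema to `R` costs a constant factor only. -/
theorem exists_quantity_le {H : ℝ → ℝ} (hH : CondH H) {R : ℝ} (hR0 : 0 < R)
    (hR : MonotoneOn (D H) (Ici R)) (N : ℕ) (γ : ℝ) {f : ℝ → ℝ} (hf : MonotoneOn f (Ioi 0)) {θ : ℝ}
    (hθ : 0 < θ) (hθ1 : θ ≤ 1) (ζ : ℝ) : ∃ κ : ℝ≥0∞, κ ≠ ⊤ ∧ ∀ η, max R ζ ≤ η →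
      quantity N γ f H θ R η ≤ κ * quantity N γ f H θ ζ η := by
  have hHR : 0 < H R := hH.pos R hR0
  set κ : ℝ≥0∞ := ENNReal.ofReal (H (max R ζ) / H R) with hκ
  have hmono := hH.strictMonoOn.monotoneOn
  have hκr : 1 ≤ H (max R ζ) / H R := by
    rw [one_le_div hHR]
    exact hmono hR0.le (hR0.le.trans (le_max_left _ _)) (le_max_left _ _)
  have hκ1 : 1 ≤ κ := by rw [hκ]; exact ENNReal.one_le_ofReal.2 hκr
  have hκt : κ ≠ ⊤ := ENNReal.ofReal_ne_top
  -- A point σ ≥ R is replaced by max σ ζ, which is admissible for the supremum from ζ. The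
  -- numerators do not decrease, and H grows at most by the factor κ.
  have hb : ∀ σ, R ≤ σ → ENNReal.ofReal (H (max σ ζ)) ≤ κ * ENNReal.ofReal (H σ) := by
    intro σ hσ
    rw [hκ, ← ENNReal.ofReal_mul (by positivity)]
    refine ENNReal.ofReal_le_ofReal ?_
    have hσ' : H R ≤ H σ := hmono hR0.le (hR0.le.trans hσ) hσ
    rcases le_total ζ σ with h | h
    · rw [max_eq_left h]
      exact le_mul_of_one_le_left (hHR.le.trans hσ') hκr
    · rw [max_eq_right h, max_eq_right (hσ.trans h)]
      have : 0 ≤ H ζ := hH.nonneg (hR0.le.trans (hσ.trans h))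
      calc H ζ = H ζ / H R * H R := by field_simp
        _ ≤ _ := by gcongr
  have hphi : ∀ ξ, max R ζ ≤ ξ → Phi H θ R ξ ≤ κ * Phi H θ ζ ξ := by
    intro ξ hξ
    refine iSup₂_le fun σ hσ => ?_
    refine (div_rpow_le_mul_div_rpow (ENNReal.ofReal_le_ofReal ?_) hκ1 hκt (hb σ hσ.1)
      (sub_nonneg.2 hθ1) (by linarith)).trans (mul_le_mul_right (div_le_Phi _ _ ?_) _)
    · exact hR hσ.1 (hσ.1.trans (le_max_left _ _)) (le_max_left _ _)
    · exact ⟨le_max_right _ _, max_le hσ.2 ((le_max_right _ _).trans hξ)⟩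
  have hpsi : ∀ ξ, max R ζ ≤ ξ → Psi f H θ R ξ ≤ κ * Psi f H θ ζ ξ := by
    intro ξ hξ
    refine iSup₂_le fun σ hσ => ?_
    refine (div_rpow_le_mul_div_rpow (ENNReal.ofReal_le_ofReal ?_) hκ1 hκt (hb σ hσ.1)
      hθ.le hθ1).trans (mul_le_mul_right (div_le_Psi _ _ _ ?_) _)
    · exact hf (hR0.trans_le hσ.1) (hR0.trans_le (hσ.1.trans (le_max_left _ _))) (le_max_left _ _)
    · exact ⟨le_max_right _ _, max_le hσ.2 ((le_max_right _ _).trans hξ)⟩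
  refine ⟨κ * κ, ENNReal.mul_ne_top hκt hκt, fun η hη => ?_⟩
  unfold quantity
  rw [mul_mul_mul_comm]
  refine mul_le_mul' (hphi η hη) ?_
  rw [← lintegral_const_mul' _ _ hκt]
  refine setLIntegral_mono' measurableSet_Ioi fun τ hτ => ?_
  rw [← mul_assoc]
  gcongr
  exact hpsi τ (hη.trans (le_of_lt hτ))

/-- The change of variables `H(τ) = A s^{-N/2}`. -/
theorem lintegral_Ioo_le_lintegral_Ioi {H : ℝ → ℝ} (hH : CondH H) {R : ℝ} (hR0 : 0 < R) {N : ℕ}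
    (hN : 1 ≤ N) (γ : ℝ) {J : ℝ → ℝ} (hJ : ∀ z, H R ≤ z → R ≤ J z ∧ H (J z) = z) {A t : ℝ}
    (hA : 0 < A) (ht : 0 < t) (hAt : H R ≤ A * t ^ (-((N : ℝ) / 2))) (P : ℝ → ℝ≥0∞) :
    ∫⁻ s in Ioo 0 t, P (J (A * s ^ (-((N : ℝ) / 2)))) *
        ENNReal.ofReal ((s * (t - s) / t) ^ (-(γ / 2))) ≤
      ENNReal.ofReal (2 / N * A ^ ((2 - γ) / (N : ℝ))) *
        ∫⁻ τ in Ioi (J (A * t ^ (-((N : ℝ) / 2)))), P τ *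
          ENNReal.ofReal (D H τ / H τ ^ (1 + (2 - γ) / (N : ℝ)) *
            (1 - (H (J (A * t ^ (-((N : ℝ) / 2)))) / H τ) ^ (2 / (N : ℝ))) ^ (-(γ / 2))) := by
  have hNp : (0 : ℝ) < N := by exact_mod_cast hN
  set n : ℝ := (N : ℝ) with hn
  obtain ⟨hηR, hHη⟩ := hJ _ hAt
  set η := J (A * t ^ (-(n / 2))) with hη
  have hmono := hH.strictMonoOn
  have hη0 : 0 < η := hR0.trans_le hηR
  -- The solution s = σ(τ) of H(τ) = A s^{-N/2}.
  set σ : ℝ → ℝ := fun τ => A ^ (2 / n) * H τ ^ (-(2 / n)) with hσ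
  set σ' : ℝ → ℝ := fun τ => A ^ (2 / n) * (D H τ * (-(2 / n)) * H τ ^ (-(2 / n) - 1)) with hσ'
  have hpos : ∀ τ ∈ Ioi η, 0 < H τ := fun τ hτ => hH.pos τ (hη0.trans hτ)
  have hinv1 : ∀ h : ℝ, 0 < h → A * (A ^ (2 / n) * h ^ (-(2 / n))) ^ (-(n / 2)) = h := by
    intro h hh
    rw [Real.mul_rpow (by positivity) (by positivity), ← Real.rpow_mul hA.le, ← Real.rpow_mul hh.le,
      show 2 / n * -(n / 2) = -1 by field_simp, show -(2 / n) * -(n / 2) = 1 by field_simp,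
      Real.rpow_neg_one, Real.rpow_one]
    field_simp
  have hinv2 : ∀ s : ℝ, 0 < s → A ^ (2 / n) * (A * s ^ (-(n / 2))) ^ (-(2 / n)) = s := by
    intro s hs
    rw [Real.mul_rpow hA.le (by positivity), ← Real.rpow_mul hs.le, ← mul_assoc,
      ← Real.rpow_add hA, show -(n / 2) * -(2 / n) = 1 by field_simp]
    simp
  have hder : ∀ τ ∈ Ioi η, HasDerivWithinAt σ (σ' τ) (Ioi η) τ := fun τ hτ =>
    (((hH.hasDerivAt (hη0.trans hτ)).rpow_const (Or.inl (hpos τ hτ).ne')).const_mul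
      _).hasDerivWithinAt
  have hinj : InjOn σ (Ioi η) := by
    intro a ha b hb hab
    have h1 := hinv1 _ (hpos a ha)
    have h2 := hinv1 _ (hpos b hb)
    have hab' : A ^ (2 / n) * H a ^ (-(2 / n)) = A ^ (2 / n) * H b ^ (-(2 / n)) := hab
    rw [hab', h2] at h1
    exact hmono.injOn (hη0.trans ha).le (hη0.trans hb).le h1.symm
  -- One inclusion is enough for an upper bound.
  have hsub : Ioo 0 t ⊆ σ '' Ioi η := by
    intro s hs
    have hlt : A * t ^ (-(n / 2)) < A * s ^ (-(n / 2)) := by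
      have := Real.rpow_lt_rpow_of_neg hs.1 hs.2 (show -(n / 2) < 0 by
        rw [neg_lt_zero]; positivity)
      gcongr
    obtain ⟨h1, h2⟩ := hJ _ (hAt.trans hlt.le)
    refine ⟨J (A * s ^ (-(n / 2))), ?_, ?_⟩
    · rw [← hHη, ← h2] at hlt
      exact (hmono.lt_iff_lt hη0.le (hR0.le.trans h1)).1 hlt
    · simp only [hσ, h2]
      exact hinv2 s hs.1
  refine (lintegral_mono_set hsub).trans ?_
  rw [lintegral_image_eq_lintegral_abs_deriv_mul measurableSet_Ioi hder hinj,
    ← lintegral_const_mul' _ _ ENNReal.ofReal_ne_top]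
  refine setLIntegral_mono' measurableSet_Ioi fun τ hτ => le_of_eq ?_
  have hh := hpos τ hτ
  have hτ0 : 0 < τ := hη0.trans hτ
  have hD := hH.deriv_pos τ hτ0
  have hHητ : H η < H τ := hmono hη0.le hτ0.le hτ
  have hJτ : J (A * σ τ ^ (-(n / 2))) = τ := by
    simp only [hσ, hinv1 _ hh]
    obtain ⟨h1, h2⟩ := hJ (H τ) ((hH.strictMonoOn.monotoneOn hR0.le hτ0.le
      (hηR.trans (le_of_lt hτ))))
    exact hmono.injOn (hR0.le.trans h1) hτ0.le h2
  -- As H(η) = A t^{-N/2}, the factor (t-s)/t becomes the singular factor 1 - (H(η)/H(τ))^{2/N} of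
  -- Q.
  have hratio : σ τ / t = (H η / H τ) ^ (2 / n) := by
    rw [hHη, Real.div_rpow (by positivity) hh.le, Real.mul_rpow hA.le (by positivity),
      ← Real.rpow_mul ht.le, show -(n / 2) * (2 / n) = -1 by field_simp, Real.rpow_neg_one]
    simp only [hσ]
    rw [Real.rpow_neg hh.le]
    field_simp
  have hrl : (H η / H τ) ^ (2 / n) ≤ 1 := by
    refine Real.rpow_le_one (div_nonneg (hH.pos η hη0).le hh.le) ?_ (by positivity)
    rw [div_le_one hh]; exact hHητ.le
  rw [hJτ, mul_left_comm, mul_left_comm _ (P τ), ← ENNReal.ofReal_mul (abs_nonneg _),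
    ← ENNReal.ofReal_mul (by positivity)]
  congr 2
  have hsplit : σ τ * (t - σ τ) / t = σ τ * (1 - (H η / H τ) ^ (2 / n)) := by
    rw [← hratio]; field_simp
  have hσpos : 0 < σ τ := by simp only [hσ]; positivity
  rw [hsplit, Real.mul_rpow hσpos.le (sub_nonneg.2 hrl)]
  have habs : |σ' τ| = A ^ (2 / n) * (D H τ * (2 / n) * H τ ^ (-(2 / n) - 1)) := by
    have : σ' τ = -(A ^ (2 / n) * (D H τ * (2 / n) * H τ ^ (-(2 / n) - 1))) := by
      simp only [hσ']; ring
    rw [this, abs_neg, abs_of_nonneg (by positivity)]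
  have hσγ : σ τ ^ (-(γ / 2)) = A ^ (-(γ / n)) * H τ ^ (γ / n) := by
    simp only [hσ]
    rw [Real.mul_rpow (by positivity) (by positivity), ← Real.rpow_mul hA.le, ← Real.rpow_mul hh.le]
    congr 2 <;> field_simp
  rw [habs, hσγ, show (2 - γ) / n = 2 / n + -(γ / n) by ring, Real.rpow_add hA, div_eq_mul_inv (D H τ),
    ← Real.rpow_neg hh.le, show -(1 + (2 / n + -(γ / n))) = (-(2 / n) - 1) + γ / n by ring,
    Real.rpow_add hh]
  ring

/-- `H⁻¹(2 e^{tΔ} H(w))` is a supersolution. -/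
theorem duhamel_supersolution_le {H : ℝ → ℝ} (hH : CondH H) {R : ℝ} (hR0 : 0 < R)
    (hR : MonotoneOn (D H) (Ici R)) {N : ℕ} (hN : 1 ≤ N) {γ C : ℝ} (hγ : 0 < γ) (hC0 : 0 < C)
    (hC : ∀ (m : E N) (τ : ℝ), 0 < τ →
      ∫⁻ y, ENNReal.ofReal (heatKernel (y - m) τ) * ENNReal.ofReal (‖y‖ ^ (-γ)) ≤
        ENNReal.ofReal C * ENNReal.ofReal (τ ^ (-(γ / 2))))
    {g : ℝ → ℝ} {θ : ℝ} (hθ : 0 < θ) (hθ1 : θ ≤ 1)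
    {J : ℝ → ℝ} (hJ : ∀ z, H R ≤ z → R ≤ J z ∧ H (J z) = z)
    {w : E N → ℝ} (hw : Measurable w) (hwR : ∀ y, R ≤ w y)
    (hφ : Measurable (fun y => ENNReal.ofReal (H (w y)))) {A T : ℝ} (hA : 0 < A)
    (hAv : ∀ t ∈ Ioo 0 T, ∀ x, 2 * heatFlow t (fun y => ENNReal.ofReal (H (w y))) x ≤
      ENNReal.ofReal (A * t ^ (-((N : ℝ) / 2))))
    (hQ : ∀ t ∈ Ioo 0 T, ENNReal.ofReal (2 * C * (2 / N * A ^ ((2 - γ) / (N : ℝ)))) *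
      quantity N γ g H θ R (J (A * t ^ (-((N : ℝ) / 2)))) ≤ 1)
    {t : ℝ} (ht : t ∈ Ioo 0 T) (x : E N) :
    duhamel γ g (fun y => ENNReal.ofReal (w y)) (fun x t => ENNReal.ofReal
      (J (2 * heatFlow t (fun y => ENNReal.ofReal (H (w y))) x).toReal)) x t ≤
      ENNReal.ofReal (J (2 * heatFlow t (fun y => ENNReal.ofReal (H (w y))) x).toReal) := by
  set φ : E N → ℝ≥0∞ := fun y => ENNReal.ofReal (H (w y)) with hφdef
  set p : E N → ℝ → ℝ := fun x t => J (2 * heatFlow t φ x).toReal with hp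
  set η : ℝ → ℝ := fun s => J (A * s ^ (-((N : ℝ) / 2))) with hη
  have hHR : 0 < H R := hH.pos R hR0
  have hmono := hH.strictMonoOn
  have hfin : ∀ s ∈ Ioo 0 T, ∀ y, 2 * heatFlow s φ y ≠ ⊤ := fun s hs y =>
    ((hAv s hs y).trans_lt ENNReal.ofReal_lt_top).ne
  have hge : ∀ s ∈ Ioo 0 T, ∀ y, ENNReal.ofReal (H R) ≤ 2 * heatFlow s φ y := by
    intro s hs y
    calc ENNReal.ofReal (H R) = heatFlow s (fun _ => ENNReal.ofReal (H R)) y :=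
          (heatFlow_const hs.1 _ y).symm
      _ ≤ heatFlow s φ y := heatFlow_mono (ae_of_all _ fun z => ENNReal.ofReal_le_ofReal
          (hmono.monotoneOn hR0.le (hR0.le.trans (hwR z)) (hwR z))) y
      _ ≤ _ := le_mul_of_one_le_left' (by norm_num)
  have hgeA : ∀ s ∈ Ioo 0 T, H R ≤ A * s ^ (-((N : ℝ) / 2)) := fun s hs =>
    (ENNReal.ofReal_le_ofReal_iff (by have := hs.1; positivity)).1
      ((hge s hs x).trans (hAv s hs x))
  have hpp : ∀ s ∈ Ioo 0 T, ∀ y, R ≤ p y s ∧ ENNReal.ofReal (H (p y s)) = 2 * heatFlow s φ y ∧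
      p y s ≤ η s := by
    intro s hs y
    obtain ⟨h1, h2⟩ := hJ (2 * heatFlow s φ y).toReal
      ((ENNReal.ofReal_le_iff_le_toReal (hfin s hs y)).1 (hge s hs y))
    obtain ⟨h3, h4⟩ := hJ _ (hgeA s hs)
    refine ⟨h1, by rw [hp]; simp only [h2, ENNReal.ofReal_toReal (hfin s hs y)], ?_⟩
    refine (hmono.le_iff_le (hR0.le.trans h1) (hR0.le.trans h3)).1 ?_
    rw [h2, h4]
    exact ENNReal.toReal_le_of_le_ofReal (by have := hs.1; positivity) (hAv s hs y)
  obtain ⟨hpR, hpH, hpη⟩ := hpp t ht x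
  set v := heatFlow t φ x with hv
  have hvt : v ≠ ⊤ := fun h => hfin t ht x (by rw [← hv, h]; exact ENNReal.mul_top two_ne_zero)
  have hp0 : 0 < p x t := hR0.trans_le hpR
  have hD : 0 < D H (p x t) := hH.deriv_pos _ hp0
  -- Tangent inequality at the fixed number p(x,t), rearranged to avoid subtraction and averaged in
  -- y. Since H(p) = 2v, one finite copy of v cancels and one remains as margin.
  have hlin : ENNReal.ofReal (D H (p x t)) * heatFlow t (fun y => ENNReal.ofReal (w y)) x + v ≤
      ENNReal.ofReal (D H (p x t)) * ENNReal.ofReal (p x t) := by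
    have h1 : heatFlow t (fun y => ENNReal.ofReal (D H (p x t)) * ENNReal.ofReal (w y) +
        ENNReal.ofReal (H (p x t))) x ≤ heatFlow t (fun y => φ y +
        ENNReal.ofReal (D H (p x t)) * ENNReal.ofReal (p x t)) x := by
      refine heatFlow_mono (ae_of_all _ fun y => ?_) x
      have hwy := hR0.trans_le (hwR y)
      have hHw := hH.pos _ hwy
      have hHp := hH.pos _ hp0
      rw [hφdef]
      simp only
      rw [← ENNReal.ofReal_mul hD.le, ← ENNReal.ofReal_mul hD.le,
        ← ENNReal.ofReal_add (by positivity) (by positivity),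
        ← ENNReal.ofReal_add (by positivity) (by positivity)]
      refine ENNReal.ofReal_le_ofReal ?_
      have := hH.tangent_le hR0 hR hpR (hwR y)
      linarith
    rw [heatFlow_add _ (by fun_prop), heatFlow_add _ hφ.aemeasurable,
      heatFlow_const_mul _ _ (by fun_prop), heatFlow_const ht.1, heatFlow_const ht.1, hpH, ← hv,
      two_mul, ← add_assoc, add_comm v] at h1
    exact (ENNReal.add_le_add_iff_right hvt).1 h1
  -- The source must fit into the margin v. The bound p(·,s) ≤ η(s) allows Ψ to be evaluated at
  -- η(s), uniformly in space.
  have hsource : ENNReal.ofReal (D H (p x t)) * ∫⁻ s in Ioo (0 : ℝ) t,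
      heatFlow (t - s) (fun y => ENNReal.ofReal (‖y‖ ^ (-γ) * g (ENNReal.ofReal (p y s)).toReal)) x
      ≤ v := by
    have h1 : ∀ s ∈ Ioo 0 t, heatFlow (t - s)
        (fun y => ENNReal.ofReal (‖y‖ ^ (-γ) * g (ENNReal.ofReal (p y s)).toReal)) x ≤
        2 ^ θ * ENNReal.ofReal C * v ^ θ *
          (Psi g H θ R (η s) * ENNReal.ofReal ((s * (t - s) / t) ^ (-(γ / 2)))) := by
      intro s hs
      have hs' : s ∈ Ioo 0 T := ⟨hs.1, hs.2.trans ht.2⟩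
      have hvm : Measurable (fun y => heatFlow s φ y) :=
        measurable_heatFlow (τ := fun _ => s) (x := fun y => y) (φ := fun _ => φ) (by fun_prop)
          (by fun_prop) (by fun_prop)
      calc _ ≤ heatFlow (t - s) (fun y => (Psi g H θ R (η s) * 2 ^ θ) *
            (ENNReal.ofReal (‖y‖ ^ (-γ)) * heatFlow s φ y ^ θ)) x := by
            refine heatFlow_mono (ae_of_all _ fun y => ?_) x
            obtain ⟨hyR, hyH, hyη⟩ := hpp s hs' y
            have hHy : 0 < H (p y s) := hH.pos _ (hR0.trans_le hyR)
            rw [ENNReal.toReal_ofReal (hR0.le.trans hyR), ENNReal.ofReal_mul (by positivity),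
              mul_left_comm, mul_assoc (Psi g H θ R (η s)),
              ← ENNReal.mul_rpow_of_nonneg _ _ hθ.le, ← hyH]
            refine mul_le_mul_right ?_ _
            refine (ENNReal.div_le_iff ?_ ?_).1 (div_le_Psi g H θ ⟨hyR, hyη⟩)
            · exact (ENNReal.rpow_pos (ENNReal.ofReal_pos.2 hHy) ENNReal.ofReal_ne_top).ne'
            · exact ENNReal.rpow_ne_top_of_nonneg hθ.le ENNReal.ofReal_ne_top
        _ ≤ (Psi g H θ R (η s) * 2 ^ θ) * (ENNReal.ofReal C *
            ENNReal.ofReal ((s * (t - s) / t) ^ (-(γ / 2))) * v ^ θ) := by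
            rw [heatFlow_const_mul _ _ (by fun_prop)]
            exact mul_le_mul_right
              (heatFlow_norm_rpow_mul_heatFlow_rpow_le hγ hC hθ hθ1 hs.1 hs.2 hφ x) _
        _ = _ := by ring
    have hDp : ENNReal.ofReal (D H (p x t)) ≤ Phi H θ R (η t) * (2 * v) ^ (1 - θ) := by
      rw [← hpH]
      refine (ENNReal.div_le_iff ?_ ?_).1 (div_le_Phi H θ ⟨hpR, hpη⟩)
      · exact (ENNReal.rpow_pos (ENNReal.ofReal_pos.2 (hH.pos _ hp0)) ENNReal.ofReal_ne_top).ne'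
      · exact ENNReal.rpow_ne_top_of_nonneg (sub_nonneg.2 hθ1) ENNReal.ofReal_ne_top
    have hvθ : (2 * v) ^ (1 - θ) * (2 ^ θ * v ^ θ) = 2 * v := by
      rw [← ENNReal.mul_rpow_of_nonneg _ _ hθ.le,
        ← ENNReal.rpow_add_of_nonneg _ _ (sub_nonneg.2 hθ1) hθ.le, sub_add_cancel, ENNReal.rpow_one]
    have hcv := lintegral_Ioo_le_lintegral_Ioi hH hR0 hN γ hJ hA ht.1 (hgeA t ht) (Psi g H θ R)
    calc _ ≤ Phi H θ R (η t) * (2 * v) ^ (1 - θ) * (2 ^ θ * ENNReal.ofReal C * v ^ θ *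
          ∫⁻ s in Ioo 0 t, Psi g H θ R (η s) *
            ENNReal.ofReal ((s * (t - s) / t) ^ (-(γ / 2)))) := by
          refine mul_le_mul' hDp ?_
          refine (setLIntegral_mono' measurableSet_Ioo h1).trans (le_of_eq ?_)
          refine lintegral_const_mul' _ _ (ENNReal.mul_ne_top (ENNReal.mul_ne_top ?_
            ENNReal.ofReal_ne_top) (ENNReal.rpow_ne_top_of_nonneg hθ.le hvt))
          exact ENNReal.rpow_ne_top_of_nonneg hθ.le (by norm_num)
      _ = (2 * v) ^ (1 - θ) * (2 ^ θ * v ^ θ) * (ENNReal.ofReal C * (Phi H θ R (η t) *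
          ∫⁻ s in Ioo 0 t, Psi g H θ R (η s) *
            ENNReal.ofReal ((s * (t - s) / t) ^ (-(γ / 2))))) := by ring
      _ ≤ 2 * v * (ENNReal.ofReal C * (Phi H θ R (η t) * (ENNReal.ofReal (2 / N *
          A ^ ((2 - γ) / (N : ℝ))) * ∫⁻ τ in Ioi (η t), Psi g H θ R τ *
          ENNReal.ofReal (D H τ / H τ ^ (1 + (2 - γ) / (N : ℝ)) *
            (1 - (H (η t) / H τ) ^ (2 / (N : ℝ))) ^ (-(γ / 2)))))) := by
          rw [hvθ]
          gcongr
      _ = v * (ENNReal.ofReal (2 * C * (2 / N * A ^ ((2 - γ) / (N : ℝ)))) *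
          quantity N γ g H θ R (η t)) := by
          rw [ENNReal.ofReal_mul (p := 2 * C) (by positivity),
            ENNReal.ofReal_mul (p := 2) zero_le_two, ENNReal.ofReal_ofNat]
          unfold quantity
          ring
      _ ≤ v * 1 := mul_le_mul_right (hQ t ht) _
      _ = v := mul_one v
  have hfinal : ENNReal.ofReal (D H (p x t)) * duhamel γ g (fun y => ENNReal.ofReal (w y))
      (fun x t => ENNReal.ofReal (p x t)) x t ≤
      ENNReal.ofReal (D H (p x t)) * ENNReal.ofReal (p x t) := by
    unfold duhamel
    rw [mul_add]
    exact (add_le_add_right hsource _).trans hlin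
  exact (ENNReal.mul_le_mul_iff_right (ENNReal.ofReal_pos.2 hD).ne' ENNReal.ofReal_ne_top).1 hfinal

/-- The heat flow of a function that is a bounded perturbation of a uniformly local one. -/
theorem exists_two_mul_heatFlow_le {N : ℕ} (hN : 1 ≤ N) {K : ℝ} (hK0 : 0 < K)
    (hK : ∀ (φ : E N → ℝ≥0∞),
      AEMeasurable φ → ∀ M : ℝ≥0∞, (∀ y, ∫⁻ x in Metric.ball y 1, φ x ≤ M) →
      ∀ t : ℝ, 0 < t → t ≤ 1 → ∀ x,
        heatFlow t φ x ≤ ENNReal.ofReal (K * t ^ (-((N : ℝ) / 2))) * M)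
    {φ ψ : E N → ℝ≥0∞} (hψ : AEMeasurable ψ) {b δ A : ℝ} (hb : 0 ≤ b) (hδ : 0 ≤ δ)
    (hφ : ∀ᵐ y, φ y ≤ ψ y + ENNReal.ofReal b)
    (hψδ : ∀ y, ∫⁻ x in Metric.ball y 1, ψ x ≤ ENNReal.ofReal δ) (hA : 2 * K * δ < A) :
    ∀ᶠ t in 𝓝[>] (0 : ℝ), ∀ x, 2 * heatFlow t φ x ≤
      ENNReal.ofReal (A * t ^ (-((N : ℝ) / 2))) := by
  have hNp : (0 : ℝ) < N := by exact_mod_cast hN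
  -- The strict gap between A and 2Kδ, multiplied by t^{-N/2}, eventually absorbs the bounded part
  -- 2b.
  have h1 : Tendsto (fun t : ℝ => (A - 2 * K * δ) * t ^ (-((N : ℝ) / 2))) (𝓝[>] 0) atTop :=
    (tendsto_rpow_neg_nhdsGT_zero (by rw [neg_lt_zero]; positivity)).const_mul_atTop (sub_pos.2 hA)
  filter_upwards [h1.eventually_ge_atTop (2 * b), self_mem_nhdsWithin,
    nhdsWithin_le_nhds (Iic_mem_nhds (zero_lt_one' ℝ))] with t ht ht0 ht1 x
  have ht0 : 0 < t := ht0
  calc 2 * heatFlow t φ x ≤ 2 * (heatFlow t (fun y => ψ y + ENNReal.ofReal b) x) := by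
        gcongr
        exact heatFlow_mono hφ x
    _ ≤ 2 * (ENNReal.ofReal (K * t ^ (-((N : ℝ) / 2))) * ENNReal.ofReal δ + ENNReal.ofReal b) := by
        rw [heatFlow_add _ hψ, heatFlow_const ht0]
        gcongr
        exact hK ψ hψ _ hψδ t ht0 ht1 x
    _ ≤ _ := by
        rw [← ENNReal.ofReal_mul (by positivity), ← ENNReal.ofReal_add (by positivity) hb,
          ← ENNReal.ofReal_ofNat 2, ← ENNReal.ofReal_mul (by norm_num)]
        refine ENNReal.ofReal_le_ofReal ?_
        linarith

/-! ### Construction of the solution below the supersolution. -/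

theorem memLul_of_bounded {N : ℕ} {φ : E N → ℝ} (hφ : Measurable φ) {b : ℝ}
    (hb : ∀ x, ‖φ x‖ ≤ b) {M : ℝ≥0∞} (hM : M ≠ ⊤)
    (h : ∀ y, ∫⁻ x in Metric.ball y 1, ‖φ x‖ₑ ≤ M) : MemLul φ ∧ ulNorm φ ≤ M := by
  have h1 : ulNorm φ ≤ M := iSup_le h
  refine ⟨⟨(locallyIntegrable_const b).mono hφ.aestronglyMeasurable (ae_of_all _ fun x => ?_),
    h1.trans_lt hM.lt_top⟩, h1⟩
  exact (hb x).trans (le_abs_self b)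

/-- The iteration uses a nonlinearity monotone on all of ℝ. Continuity at 0 carries the monotonicity
of f to the closed half-line, and f is then frozen on negative arguments. -/
theorem monotone_comp_max_zero {f : ℝ → ℝ} (hf : ContinuousOn f (Ici 0))
    (hm : MonotoneOn f (Ioi 0)) : Monotone (fun ξ => f (max ξ 0)) := by
  have h : MonotoneOn f (Ici 0) := by
    intro a ha b hb hab
    rcases eq_or_lt_of_le (mem_Ici.1 ha) with rfl | ha
    · rcases eq_or_lt_of_le hab with rfl | hb'
      · exact le_rfl
      · refine le_of_tendsto ((hf 0 self_mem_Ici).mono_left (nhdsWithin_mono _ Ioi_subset_Ici_self))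
          ?_
        filter_upwards [self_mem_nhdsWithin, nhdsWithin_le_nhds (Iic_mem_nhds hb')] with y hy hyb
        exact hm hy hb' hyb
    · exact hm ha (ha.trans_le hab) hab
  intro a b hab
  exact h (mem_Ici.2 (le_max_right _ _)) (mem_Ici.2 (le_max_right _ _)) (max_le_max_right _ hab)

theorem continuous_comp_max_zero {f : ℝ → ℝ} (hf : ContinuousOn f (Ici 0)) :
    Continuous (fun ξ => f (max ξ 0)) :=
  hf.comp_continuous (by fun_prop) fun ξ => le_max_right ξ 0

theorem quantity_comp_max_zero (N : ℕ) (γ : ℝ) (f H : ℝ → ℝ) (θ : ℝ) {R : ℝ} (hR : 0 ≤ R) (η : ℝ) :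
    quantity N γ (fun ξ => f (max ξ 0)) H θ R η = quantity N γ f H θ R η := by
  have h : Psi (fun ξ => f (max ξ 0)) H θ R = Psi f H θ R := by
    funext ξ
    refine iSup_congr fun σ => iSup_congr fun hσ => ?_
    simp only [max_eq_left (hR.trans hσ.1)]
  unfold quantity
  rw [h]

theorem exists_isSolution {H : ℝ → ℝ} (hH : CondH H) {R : ℝ} (hR0 : 0 < R)
    (hR : MonotoneOn (D H) (Ici R)) {N : ℕ} (hN : 1 ≤ N) {γ C : ℝ} (hγ : 0 < γ) (hC0 : 0 < C)
    (hC : ∀ (m : E N) (τ : ℝ), 0 < τ →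
      ∫⁻ y, ENNReal.ofReal (heatKernel (y - m) τ) * ENNReal.ofReal (‖y‖ ^ (-γ)) ≤
        ENNReal.ofReal C * ENNReal.ofReal (τ ^ (-(γ / 2))))
    {f : ℝ → ℝ} (hf : ContinuousOn f (Ici 0)) (hfm : MonotoneOn f (Ioi 0))
    {θ : ℝ} (hθ : 0 < θ) (hθ1 : θ ≤ 1) {u₀ : E N → ℝ} (hu₀ : Measurable u₀)
    {M : ℝ≥0∞} (hM : M ≠ ⊤)
    (hφM : ∀ y, ∫⁻ x in Metric.ball y 1, ENNReal.ofReal (H (max (u₀ x) R)) ≤ M)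
    {A : ℝ} (hA : 0 < A)
    (hAv : ∀ᶠ t in 𝓝[>] (0 : ℝ), ∀ x,
      2 * heatFlow t (fun y => ENNReal.ofReal (H (max (u₀ y) R))) x ≤
        ENNReal.ofReal (A * t ^ (-((N : ℝ) / 2))))
    (hQ : ∀ᶠ η in atTop, ENNReal.ofReal (2 * C * (2 / N * A ^ ((2 - γ) / (N : ℝ)))) *
      quantity N γ f H θ R η ≤ 1) :
    ∃ T : ℝ, 0 < T ∧ ∃ u : E N → ℝ → ℝ, IsSolution γ f u₀ T u ∧
      ∀ t ∈ Ioo (0 : ℝ) T, MemLul (fun x => H (u x t)) ∧ ulNorm (fun x => H (u x t)) ≤ 2 * M := by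
  have hNp : (0 : ℝ) < N := by exact_mod_cast hN
  have hHR : 0 < H R := hH.pos R hR0
  have hmono := hH.strictMonoOn
  obtain ⟨J, hJ⟩ := hH.exists_rightInverse hR0
  have hJge : ∀ a z, R ≤ a → H a ≤ z → a ≤ J z := by
    intro a z ha haz
    obtain ⟨h1, h2⟩ := hJ z ((hmono.monotoneOn hR0.le (hR0.le.trans ha) ha).trans haz)
    refine (hmono.le_iff_le (hR0.le.trans ha) (hR0.le.trans h1)).1 ?_
    rwa [h2]
  have hQ' : ∀ᶠ t in 𝓝[>] (0 : ℝ), ENNReal.ofReal (2 * C * (2 / N * A ^ ((2 - γ) / (N : ℝ)))) *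
      quantity N γ (fun ξ => f (max ξ 0)) H θ R (J (A * t ^ (-((N : ℝ) / 2)))) ≤ 1 := by
    obtain ⟨η₀, hη₀⟩ := eventually_atTop.1 hQ
    have h1 : Tendsto (fun t : ℝ => A * t ^ (-((N : ℝ) / 2))) (𝓝[>] 0) atTop :=
      (tendsto_rpow_neg_nhdsGT_zero (by rw [neg_lt_zero]; positivity)).const_mul_atTop hA
    filter_upwards [h1.eventually_ge_atTop (H (max η₀ R))] with t ht
    rw [quantity_comp_max_zero N γ f H θ hR0.le]
    exact hη₀ _ ((le_max_left _ _).trans (hJge _ _ (le_max_right _ _) ht))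
  obtain ⟨T, hT0, hT⟩ := mem_nhdsGT_iff_exists_Ioo_subset.1 (hAv.and hQ')
  have hT0 : 0 < T := hT0
  set w : E N → ℝ := fun y => max (u₀ y) R with hw
  set φ : E N → ℝ≥0∞ := fun y => ENNReal.ofReal (H (w y)) with hφdef
  have hwm : Measurable w := hu₀.max measurable_const
  have hHc := continuous_comp_max_zero hH.continuousOn
  have hφ : Measurable φ := by
    have : φ = fun y => ENNReal.ofReal (H (max (w y) 0)) := by
      funext y
      rw [hφdef, max_eq_left (hR0.le.trans (le_max_right _ _))]
    rw [this]
    exact ENNReal.measurable_ofReal.comp (hHc.measurable.comp hwm)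
  set p : E N → ℝ → ℝ := fun x t => J (2 * heatFlow t φ x).toReal with hp
  have hsuper : ∀ t ∈ Ioo 0 T, ∀ x, duhamel γ (fun ξ => f (max ξ 0))
      (fun y => ENNReal.ofReal (w y)) (fun x t => ENNReal.ofReal (p x t)) x t ≤
      ENNReal.ofReal (p x t) := fun t ht x =>
    duhamel_supersolution_le hH hR0 hR hN hγ hC0 hC hθ hθ1 hJ hwm (fun y => le_max_right _ _) hφ hA
      (fun t ht => (hT ht).1) (fun t ht => (hT ht).2) ht x
  have hfin : ∀ t ∈ Ioo 0 T, ∀ x, 2 * heatFlow t φ x ≠ ⊤ := fun s hs y =>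
    (((hT hs).1 y).trans_lt ENNReal.ofReal_lt_top).ne
  have hpp : ∀ t ∈ Ioo 0 T, ∀ x, R ≤ p x t ∧ H (p x t) = (2 * heatFlow t φ x).toReal := by
    intro t ht x
    refine hJ _ ((ENNReal.ofReal_le_iff_le_toReal (hfin t ht x)).1 ?_)
    calc ENNReal.ofReal (H R) = heatFlow t (fun _ => ENNReal.ofReal (H R)) x :=
          (heatFlow_const ht.1 _ x).symm
      _ ≤ heatFlow t φ x := heatFlow_mono (ae_of_all _ fun z => ENNReal.ofReal_le_ofReal
          (hmono.monotoneOn hR0.le (hR0.le.trans (le_max_right _ _)) (le_max_right _ _))) x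
      _ ≤ _ := le_mul_of_one_le_left' (by norm_num)
  obtain ⟨U, hUm, hUp, hU⟩ := exists_fixed_point_duhamel_le
    (monotone_comp_max_zero hf hfm) (continuous_comp_max_zero hf)
    (w := fun y => ENNReal.ofReal (u₀ y)) (by fun_prop)
    (V := fun x t => ENNReal.ofReal (p x t)) (T := T) (fun _ _ _ => ENNReal.ofReal_lt_top)
    -- The supersolution was built for the larger datum w = max(u₀, R), so it also serves u₀.
    fun t ht x => le_trans (add_le_add_left (heatFlow_mono
      (ae_of_all _ fun y => ENNReal.ofReal_le_ofReal (le_max_left _ _)) x) _) (hsuper t ht x)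
  have hUt : ∀ t ∈ Ioo 0 T, ∀ x, U x t ≠ ⊤ := fun t ht x =>
    ((hUp t ht x).trans_lt ENNReal.ofReal_lt_top).ne
  have hup : ∀ t ∈ Ioo 0 T, ∀ x, (U x t).toReal ≤ p x t := fun t ht x =>
    ENNReal.toReal_le_of_le_ofReal (hR0.le.trans (hpp t ht x).1) (hUp t ht x)
  have hum : ∀ t, Measurable (fun x => (U x t).toReal) := fun t =>
    (hUm.comp (f := fun x : E N => (x, t)) (by fun_prop)).ennreal_toReal
  have hHp : ∀ t ∈ Ioo 0 T, ∀ x, H (p x t) ≤ A * t ^ (-((N : ℝ) / 2)) := by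
    intro t ht x
    rw [(hpp t ht x).2]
    exact ENNReal.toReal_le_of_le_ofReal (by have := ht.1; positivity) ((hT ht).1 x)
  have hHpe : ∀ t ∈ Ioo 0 T, ∀ x, ENNReal.ofReal (H (p x t)) = 2 * heatFlow t φ x := by
    intro t ht x
    rw [(hpp t ht x).2, ENNReal.ofReal_toReal (hfin t ht x)]
  have hball : ∀ t ∈ Ioo 0 T, ∀ y, ∫⁻ x in Metric.ball y 1, ENNReal.ofReal (H (p x t)) ≤ 2 * M := by
    intro t ht y
    simp_rw [hHpe t ht]
    rw [lintegral_const_mul' _ _ (by norm_num)]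
    gcongr
    exact setLIntegral_ball_heatFlow_le hφ hφM ht.1 y
  have hHu : ∀ t ∈ Ioo 0 T, ∀ x, H (U x t).toReal ≤ H (p x t) := fun t ht x =>
    hmono.monotoneOn (mem_Ici.2 ENNReal.toReal_nonneg) (hR0.le.trans (hpp t ht x).1) (hup t ht x)
  have hDR : 0 < D H R := hH.deriv_pos R hR0
  -- The tangent at R makes H grow at least linearly, so bounds on H(p) pass to p and hence to u.
  have hplin : ∀ t ∈ Ioo 0 T, ∀ x, p x t ≤ R + (D H R)⁻¹ * H (p x t) := by
    intro t ht x
    have := hH.tangent_le hR0 hR le_rfl (hpp t ht x).1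
    have h2 : p x t - R ≤ H (p x t) / D H R := by
      rw [le_div_iff₀ hDR]; linarith
    rw [div_eq_inv_mul] at h2
    linarith
  refine ⟨T, hT0, fun x t => (U x t).toReal, ⟨?_, fun _ _ _ => ENNReal.toReal_nonneg, ?_, ?_, ?_⟩, ?_⟩
  · exact (hUm.comp (f := fun q : E N × Ioo (0 : ℝ) T => (q.1, (q.2 : ℝ)))
      (by fun_prop)).ennreal_toReal
  · set M' : ℝ≥0∞ := ENNReal.ofReal R * volume (Metric.ball (0 : E N) 1) +
      ENNReal.ofReal (D H R)⁻¹ * (2 * M) with hM'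
    have hM't : M' ≠ ⊤ := ENNReal.add_ne_top.2
      ⟨ENNReal.mul_ne_top ENNReal.ofReal_ne_top measure_ball_lt_top.ne,
        ENNReal.mul_ne_top ENNReal.ofReal_ne_top (ENNReal.mul_ne_top (by norm_num) hM)⟩
    refine ⟨M'.toNNReal, ae_restrict_of_forall_mem measurableSet_Ioo fun t ht => ?_⟩
    rw [ENNReal.coe_toNNReal hM't]
    refine memLul_of_bounded (hum t) (b := R + (D H R)⁻¹ * (A * t ^ (-((N : ℝ) / 2))))
      (fun x => ?_) hM't fun y => ?_
    · rw [Real.norm_of_nonneg ENNReal.toReal_nonneg]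
      refine (hup t ht x).trans ((hplin t ht x).trans ?_)
      gcongr
      exact hHp t ht x
    · calc _ ≤ ∫⁻ x in Metric.ball y 1, (ENNReal.ofReal R +
            ENNReal.ofReal (D H R)⁻¹ * ENNReal.ofReal (H (p x t))) := by
            refine lintegral_mono fun x => ?_
            have h0 : 0 ≤ H (p x t) := hH.nonneg (hR0.le.trans (hpp t ht x).1)
            rw [Real.enorm_eq_ofReal ENNReal.toReal_nonneg, ← ENNReal.ofReal_mul (by positivity),
              ← ENNReal.ofReal_add (by positivity) (by positivity)]
            exact ENNReal.ofReal_le_ofReal ((hup t ht x).trans (hplin t ht x))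
        _ ≤ _ := by
            rw [lintegral_add_left measurable_const, setLIntegral_const,
              lintegral_const_mul' _ _ ENNReal.ofReal_ne_top, Measure.addHaar_ball_center]
            exact add_le_add_right (mul_le_mul_right (hball t ht y) _) _
  · intro a b ha hb
    refine ⟨(R + (D H R)⁻¹ * (A * a ^ (-((N : ℝ) / 2)))).toNNReal,
      ae_restrict_of_forall_mem measurableSet_Icc fun t ht => ?_⟩
    have ht' : t ∈ Ioo 0 T := ⟨ha.trans_le ht.1, ht.2.trans_lt hb⟩
    refine (eLpNormEssSup_le_of_ae_bound (C := R + (D H R)⁻¹ * (A * a ^ (-((N : ℝ) / 2))))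
      (ae_of_all _ fun x => ?_))
    rw [Real.norm_of_nonneg ENNReal.toReal_nonneg]
    refine (hup t ht' x).trans ((hplin t ht' x).trans ?_)
    gcongr
    refine (hHp t ht' x).trans ?_
    exact mul_le_mul_of_nonneg_left
      (Real.rpow_le_rpow_of_nonpos ha ht.1 (by rw [neg_nonpos]; positivity)) hA.le
  · intro t ht
    refine ae_of_all _ fun x => ?_
    rw [ENNReal.ofReal_toReal (hUt t ht x), hU t ht x]
    unfold duhamel
    simp_rw [max_eq_left ENNReal.toReal_nonneg]
  · intro t ht
    have hHum : Measurable (fun x => H (U x t).toReal) := by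
      have : (fun x => H (U x t).toReal) = fun x => H (max (U x t).toReal 0) := by
        funext x; rw [max_eq_left ENNReal.toReal_nonneg]
      rw [this]
      exact hHc.measurable.comp (hum t)
    refine memLul_of_bounded hHum (b := A * t ^ (-((N : ℝ) / 2))) (fun x => ?_)
      (ENNReal.mul_ne_top (by norm_num) hM) fun y => ?_
    · rw [Real.norm_of_nonneg (hH.nonneg ENNReal.toReal_nonneg)]
      exact (hHu t ht x).trans (hHp t ht x)
    · refine (lintegral_mono fun x => ?_).trans (hball t ht y)
      rw [Real.enorm_eq_ofReal (hH.nonneg ENNReal.toReal_nonneg)]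
      exact ENNReal.ofReal_le_ofReal (hHu t ht x)

/-! ### Choice of A in the two cases and conclusion. -/

theorem IsSolution.congr_init {N : ℕ} {γ : ℝ} {f : ℝ → ℝ} {u₀ v₀ : E N → ℝ} {T : ℝ}
    {u : E N → ℝ → ℝ} (h : IsSolution γ f v₀ T u) (huv : u₀ =ᵐ[volume] v₀) :
    IsSolution γ f u₀ T u where
  measurable := h.measurable
  nonneg := h.nonneg
  bounded_ul := h.bounded_ul
  locally_bounded := h.locally_bounded
  mild t ht := by
    filter_upwards [h.mild t ht] with x hx
    rw [hx]
    congr 1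
    refine lintegral_congr_ae (huv.mono fun y hy => ?_)
    simp only [hy]

theorem MemLul.aemeasurable_enorm {N : ℕ} {φ : E N → ℝ} (h : MemLul φ) :
    AEMeasurable (fun x => ‖φ x‖ₑ) volume :=
  h.1.aestronglyMeasurable.enorm

theorem IsBUC.aemeasurable_enorm_sub {N : ℕ} {φ g : E N → ℝ} (hg : IsBUC g) (h : MemLul φ) :
    AEMeasurable (fun x => ‖φ x - g x‖ₑ) volume :=
  (h.1.aestronglyMeasurable.sub hg.1.continuous.aestronglyMeasurable).enorm

theorem tendsto_ofReal_const_mul_rpow {c a : ℝ} (ha : 0 < a) {k : ℝ≥0∞} (hk : k ≠ ⊤) :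
    Tendsto (fun A : ℝ => ENNReal.ofReal (c * A ^ a) * k) (𝓝[>] 0) (𝓝 0) := by
  have h1 : Tendsto (fun A : ℝ => c * A ^ a) (𝓝[>] 0) (𝓝 0) := by
    have := ((Real.continuousAt_rpow_const 0 a (Or.inr ha.le)).tendsto.const_mul c).mono_left
      (nhdsWithin_le_nhds (s := Ioi 0))
    simpa [Real.zero_rpow ha.ne'] using this
  have h2 := ENNReal.Tendsto.mul_const (ENNReal.tendsto_ofReal h1) (Or.inr hk)
  simpa using h2

end HardyParabolic

end

theorem mainTheorem3 (N : ℕ) (hN : 1 ≤ N)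
    (H : ℝ → ℝ) (hH : HardyParabolic.CondH H)
    (u₀ : HardyParabolic.E N → ℝ) (hu₀_meas : AEMeasurable u₀ volume)
    (hu₀ : ∀ᵐ x, 0 ≤ u₀ x) :
    ∃ C : ℝ, 0 < C ∧
      ∀ γ : ℝ, 0 < γ → γ < min 2 (N : ℝ) →
      ∀ f : ℝ → ℝ, ContinuousOn f (Ici 0) → (∀ ξ, 0 < ξ → 0 ≤ f ξ) → MonotoneOn f (Ioi 0) →
      ∀ θ : ℝ, 0 < θ → θ ≤ 1 → ∀ ζ : ℝ, 0 ≤ ζ →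
        ((HardyParabolic.MemLul (fun x => H (u₀ x)) ∧
            Tendsto (fun η : ℝ => HardyParabolic.quantity N γ f H θ ζ η) atTop (𝓝 0)) ∨
          (HardyParabolic.MemLulClosure (fun x => H (u₀ x)) ∧
            limsup (fun η : ℝ => HardyParabolic.quantity N γ f H θ ζ η) atTop < ⊤)) →
        ∃ T : ℝ, 0 < T ∧ ∃ u : HardyParabolic.E N → ℝ → ℝ,
          HardyParabolic.IsSolution γ f u₀ T u ∧
          ∀ t ∈ Ioo (0 : ℝ) T,
            HardyParabolic.MemLul (fun x => H (u x t)) ∧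
            HardyParabolic.ulNorm (fun x => H (u x t)) ≤ ENNReal.ofReal C := by
  open HardyParabolic in
  have hNp : (0 : ℝ) < N := by exact_mod_cast hN
  obtain ⟨R, hR0, hR⟩ := hH.deriv_mono
  have hHR : 0 < H R := hH.pos R hR0
  have hmono := hH.strictMonoOn.monotoneOn
  -- Fixed before γ, f, θ and ζ are introduced; R comes from H alone. The later `+ 1` only ensures
  -- positivity.
  set M : ℝ≥0∞ := ulNorm (fun x => H (u₀ x)) +
    ENNReal.ofReal (H R) * volume (Metric.ball (0 : E N) 1) with hMdef
  refine ⟨(2 * M).toReal + 1, by positivity, ?_⟩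
  intro γ hγ hγN f hf _ hfm θ hθ hθ1 ζ _ hcase
  have hmem : MemLul (fun x => H (u₀ x)) := hcase.elim (fun h => h.1) (fun h => h.1.1)
  have hM : M ≠ ⊤ := ENNReal.add_ne_top.2
    ⟨hmem.2.ne, ENNReal.mul_ne_top ENNReal.ofReal_ne_top measure_ball_lt_top.ne⟩
  obtain ⟨K, hK0, hK⟩ := exists_heatFlow_le_rpow_mul N
  obtain ⟨C, hC0, hC⟩ := exists_lintegral_heatKernel_mul_norm_rpow_le hN hγ
    (hγN.trans_le (min_le_right _ _))
  obtain ⟨κ, hκ, hκq⟩ := exists_quantity_le hH hR0 hR N γ hfm hθ hθ1 ζ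
  have hexp : 0 < (2 - γ) / (N : ℝ) :=
    div_pos (sub_pos.2 (hγN.trans_le (min_le_left _ _))) hNp
  set v₀ := hu₀_meas.mk u₀ with hv₀
  have hae : u₀ =ᵐ[volume] v₀ := hu₀_meas.ae_eq_mk
  have hφ : ∀ᵐ y, ENNReal.ofReal (H (max (v₀ y) R)) ≤ ‖H (u₀ y)‖ₑ + ENNReal.ofReal (H R) := by
    filter_upwards [hae, hu₀] with y hy hy0
    have h0 : 0 ≤ H (u₀ y) := hH.nonneg hy0
    rw [← hy, Real.enorm_eq_ofReal h0, ← ENNReal.ofReal_add h0 hHR.le]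
    refine ENNReal.ofReal_le_ofReal ?_
    rcases max_choice (u₀ y) R with h | h <;> rw [h] <;> linarith
  have hφM : ∀ y, ∫⁻ x in Metric.ball y 1, ENNReal.ofReal (H (max (v₀ x) R)) ≤ M := by
    intro y
    refine (lintegral_mono_ae (ae_restrict_of_ae hφ)).trans ?_
    rw [lintegral_add_right _ measurable_const, setLIntegral_const, Measure.addHaar_ball_center]
    exact add_le_add_left (le_iSup (fun y => ∫⁻ x in Metric.ball y 1, ‖H (u₀ x)‖ₑ) y) _
  have key : ∃ (A δ b : ℝ) (ψ : E N → ℝ≥0∞), 0 < A ∧ 0 ≤ δ ∧ 0 ≤ b ∧ AEMeasurable ψ volume ∧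
      (∀ᵐ y, ENNReal.ofReal (H (max (v₀ y) R)) ≤ ψ y + ENNReal.ofReal b) ∧
      (∀ y, ∫⁻ x in Metric.ball y 1, ψ x ≤ ENNReal.ofReal δ) ∧ 2 * K * δ < A ∧
      ∀ᶠ η in atTop, ENNReal.ofReal (2 * C * (2 / N * A ^ ((2 - γ) / (N : ℝ)))) *
        quantity N γ f H θ R η ≤ 1 := by
    rcases hcase with ⟨_, hQ⟩ | ⟨hcl, hQ⟩
    · set δ := (ulNorm (fun x => H (u₀ x))).toReal with hδ
      refine ⟨2 * K * δ + 1, δ, H R, fun y => ‖H (u₀ y)‖ₑ, by positivity, by positivity, hHR.le,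
        hmem.aemeasurable_enorm, hφ, fun y => ?_, by linarith, ?_⟩
      · rw [hδ, ENNReal.ofReal_toReal hmem.2.ne]
        exact le_iSup (fun y => ∫⁻ x in Metric.ball y 1, ‖H (u₀ x)‖ₑ) y
      · set c := ENNReal.ofReal (2 * C * (2 / N * (2 * K * δ + 1) ^ ((2 - γ) / (N : ℝ)))) with hc
        have h1 : Tendsto (fun η => c * κ * quantity N γ f H θ ζ η) atTop (𝓝 0) := by
          have := ENNReal.Tendsto.const_mul hQ
            (Or.inr (ENNReal.mul_ne_top ENNReal.ofReal_ne_top hκ : c * κ ≠ ⊤))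
          rwa [mul_zero] at this
        filter_upwards [h1.eventually_le_const zero_lt_one, eventually_ge_atTop (max R ζ)]
          with η h2 hη
        refine (mul_le_mul_right (hκq η hη) c).trans ?_
        rwa [← mul_assoc]
    · obtain ⟨m, hm1, hm2⟩ := exists_between hQ
      have h1 := tendsto_ofReal_const_mul_rpow (c := 2 * C * (2 / N)) hexp
        (ENNReal.mul_ne_top hκ hm2.ne)
      -- A is chosen first, small against the bound m on Q; the BUC approximation then has error
      -- A/(4K), so that 2Kδ = A/2.
      obtain ⟨A, hA1, hA⟩ := ((h1.eventually_le_const zero_lt_one).and self_mem_nhdsWithin).exists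
      have hA : 0 < A := hA
      obtain ⟨g, hg, hgε⟩ := hcl.2 (ENNReal.ofReal (A / (4 * K)))
        (ENNReal.ofReal_pos.2 (by positivity))
      obtain ⟨B, hB⟩ := hg.2
      have hB0 : 0 ≤ B := (abs_nonneg _).trans (hB 0)
      refine ⟨A, A / (4 * K), B + H R, fun y => ‖H (u₀ y) - g y‖ₑ, hA, by positivity,
        by positivity, hg.aemeasurable_enorm_sub hmem, ?_, fun y => ?_, ?_, ?_⟩
      · filter_upwards [hφ] with y hy
        refine hy.trans ?_
        rw [ENNReal.ofReal_add hB0 hHR.le, ← add_assoc]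
        refine add_le_add_left ?_ _
        calc ‖H (u₀ y)‖ₑ = ‖(H (u₀ y) - g y) + g y‖ₑ := by rw [sub_add_cancel]
          _ ≤ ‖H (u₀ y) - g y‖ₑ + ‖g y‖ₑ := enorm_add_le _ _
          _ ≤ _ := by
            refine add_le_add_right ?_ _
            rw [← ofReal_norm]
            exact ENNReal.ofReal_le_ofReal (hB y)
      · exact (le_iSup (fun y => ∫⁻ x in Metric.ball y 1, ‖H (u₀ x) - g x‖ₑ) y).trans hgε.le
      · field_simp; norm_num
      · filter_upwards [eventually_lt_of_limsup_lt hm1, eventually_ge_atTop (max R ζ)] with η h2 hη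
        refine le_trans ?_ hA1
        rw [← mul_assoc (2 * C)]
        exact mul_le_mul_right ((hκq η hη).trans (mul_le_mul_right h2.le _)) _
  obtain ⟨A, δ, b, ψ, hA, hδ, hb, hψ, hφψ, hψδ, hAδ, hQ⟩ := key
  have hAv := exists_two_mul_heatFlow_le hN hK0 hK hψ hb hδ hφψ hψδ hAδ
  obtain ⟨T, hT0, u, hu, hub⟩ := exists_isSolution hH hR0 hR hN hγ hC0 hC hf hfm hθ hθ1
    hu₀_meas.measurable_mk hM hφM hA hAv hQ
  refine ⟨T, hT0, u, hu.congr_init hae, fun t ht => ⟨(hub t ht).1, (hub t ht).2.trans ?_⟩⟩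
  rw [ENNReal.ofReal_add ENNReal.toReal_nonneg zero_le_one,
    ENNReal.ofReal_toReal (ENNReal.mul_ne_top (by norm_num) hM)]
  exact le_self_add
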